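/- **Setting.** Let $\alpha>-\tfrac12$, $l>0$, $n\in\mathbb{Z}_0^+$. Let $G_m^{(\alpha)}$ be the Gegenbauer polynomial of degree $m$ standardized by $G_m^{(\alpha)}(1)=1$, i.e. $G_0^{(\alpha)}=1$, $G_1^{(\alpha)}(x)=x$, $(m+2\alpha)G_{m+1}^{(\alpha)}(x)=2(m+\alpha)\,x\,G_m^{(\alpha)}(x)-m\,G_{m-1}^{(\alpha)}(x)$ for $m\ge1$, and let $G_{l,m}^{(\alpha)}(x)=G_m^{(\alpha)}(2x/l-1)$ be the shifted polynomial on $[0,l]$. Let $x_0<x_1<\dots<x_n$ be the zeros of $G_{l,n+1}^{(\alpha)}$ (shifted Gegenbauer–Gauss nodes), and let $\varpi_i$ be the corresponding Christoffel numbers, i.e. the weights of the Gauss quadrature at these nodes for the weight function $(x(l-x))^{\alpha-1/2}$ on $[0,l]$. With the shifted barycentric weights $$\xi_i=2(-1)^i\sqrt{4^{\alpha}\,l^{-2(1+\alpha)}\,(l-x_i)\,x_i\,\varpi_i}$$ define the barycentric Lagrange polynomials $\mathcal L_j(x)=\dfrac{\xi_j}{x-x_j}\Big/\sum_{k=0}^n\dfrac{\xi_k}{x-x_k}$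 (extended continuously to the nodes). For $q\in\mathbb{Z}^+$ the $q$th-order barycentric shifted Gegenbauer integration matrix has entries $$p^{(q)}_{ij}=\frac{(x_i-x_j)^{q-1}}{(q-1)!}\int_0^{x_i}\mathcal L_j(x)\,dx .$$ For $f$ continuous on $[0,l]$ let $I_{q,\tilde x}(f)=\int_0^{\tilde x}\int_0^{\sigma_{q-1}}\cdots\int_0^{\sigma_1}f(\sigma_0)\,d\sigma_0\cdots d\sigma_{q-1}$ be its $q$-fold integral. The $q$th-order barycentric shifted Gegenbauer quadrature (BSGQ) approximates $I_{q,x_i}(f)$ by $\sum_{j=0}^n p^{(q)}_{ij}f(x_j)$; its truncation error at $x_i$ is $$E_{q,l,n}^{(\alpha)}=E_{q,l,n}^{(\alpha)}(x_i)=I_{q,x_i}(f)-\sum_{j=0}^n p^{(q)}_{ij}f(x_j).$$ For real $z$ and $k\in\mathbb{Z}_0^+$ write $\binom zk=\frac{z(z-1)\cdots(z-k+1)}{k!}$. **Theorem.** For every $\alpha>-\tfrac12$ there exist positive constants $D_1^{(\alpha)},D_2^{(\alpha)}$ and a number $N^{(\alpha)}\in\mathbb{Z}_0^+$, depending only on $\alpha$,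 such that the following holds for all $l>0$, $n\in\mathbb{Z}_0^+$, $q\in\mathbb{Z}^+$, $f\in C^{n+1}[0,l]$, $i\in\{0,\dots,n\}$ and $A>0$ with $$\sup_{0<x<l}\left|\frac{d^{n+1}}{dx^{n+1}}\Big((x_i-x)^{q-1}f(x)\Big)\right|\le A .$$ 1. If $\alpha\ge0$, or if $-\frac12<\alpha<0$ and $n$ is odd, then $$\left|E_{q,l,n}^{(\alpha)}\right|\le\frac{A\,2^{-2n-1}\,\Gamma(\alpha+1)\,x_i\,l^{n+1}\,\Gamma(n+2\alpha+1)}{(q-1)!\,\Gamma(2\alpha+1)\,\Gamma(n+2)\,\Gamma(n+\alpha+1)}\cdot\begin{cases}1,&\alpha\ge0,\\[4pt]\dfrac{(n+1)!\,|\Gamma(2\alpha)|}{\Gamma(n+2\alpha+1)}\left|\dbinom{\frac{n+1}2+\alpha-1}{\frac{n+1}2}\right|,&\frac{n+1}2\in\mathbb{Z}^+\ \wedge\ -\frac12<\alpha<0.\end{cases}$$ 2. If $-\frac12<\alpha<0$ and $n$ is even, then $$\left|E_{q,l,n}^{(\alpha)}\right|<\frac{A\,2^{-2n-1}\,|\Gamma(\alpha)|\,|\alpha|\,x_i\,l^{n+1}}{(q-1)!\,\sqrt{(n+1)(2\alpha+n+1)}\;\Gamma(n+\alpha+1)}\left|\binom{\frac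 n2+\alpha}{\frac n2}\right| .$$ 3. With $B_1^{(\alpha)}=A\,D_1^{(\alpha)}$ and $B_2^{(\alpha)}=B_1^{(\alpha)}D_2^{(\alpha)}$, for every $n\ge N^{(\alpha)}$, $$\left|E_{q,l,n}^{(\alpha)}\right|\le\begin{cases}B_1^{(\alpha)}\,\dfrac{e^n\,l^{n+1}\,x_i}{2^{2n+1}\,n^{n+3/2-\alpha}\,(q-1)!},&\alpha\ge0,\\[10pt]B_2^{(\alpha)}\,\dfrac{e^n\,l^{n+1}\,x_i}{2^{2n+1}\,n^{n+3/2}\,(q-1)!},&-\frac12<\alpha<0.\end{cases}$$ -/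

import Mathlib

open scoped Polynomial

noncomputable section

namespace BSGQ

/-- The Gegenbauer polynomial of degree `n` and parameter `α > -1/2`, in the standardization
`G n (1) = 1`, through its three-term recurrence
`(n + 1 + 2α) G (n+2) = 2 (n + 1 + α) X G (n+1) - (n + 1) G n`.
(For `α = 0` these are the Chebyshev polynomials of the first kind.) -/
def gegenbauer (α : ℝ) : ℕ → ℝ[X]
  | 0 => 1
  | 1 => Polynomial.X
  | n + 2 =>
      Polynomial.C (((n : ℝ) + 1 + 2 * α)⁻¹) *
        (Polynomial.C (2 * ((n : ℝ) + 1 + α)) * Polynomial.X * gegenbauer α (n + 1)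
          - Polynomial.C ((n : ℝ) + 1) * gegenbauer α n)

/-- The shifted Gegenbauer polynomial `x ↦ G n (2 x / l - 1)` on `[0, l]`. -/
def shiftedGegenbauer (α l : ℝ) (n : ℕ) : ℝ[X] :=
  (gegenbauer α n).comp (Polynomial.C (2 / l) * Polynomial.X - 1)

/-- The shifted Gegenbauer–Gauss nodes `x 0 < x 1 < ⋯ < x n`: the zeros of the shifted Gegenbauer
polynomial of degree `n + 1`, listed in ascending order.  (There are exactly `n + 1` of them, so
the default value `0` is never used.) -/
def node (α l : ℝ) (n : ℕ) (i : Fin (n + 1)) : ℝ :=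
  ((shiftedGegenbauer α l (n + 1)).roots.toFinset.sort (· ≤ ·)).getD (i : ℕ) 0

/-- The Christoffel numbers, i.e. the weights of the Gauss quadrature at the nodes `x i` for the
weight function `(x (l - x)) ^ (α - 1/2)` on `[0, l]`: the weighted integrals of the fundamental
Lagrange polynomials of the nodes. -/
def christoffel (α l : ℝ) (n : ℕ) (i : Fin (n + 1)) : ℝ :=
  ∫ x in (0 : ℝ)..l, (x * (l - x)) ^ (α - 1 / 2) *
    (Lagrange.basis Finset.univ (node α l n) i).eval x

/-- The shifted barycentric weights. -/
def baryWeight (α l : ℝ) (n : ℕ) (i : Fin (n + 1)) : ℝ :=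
  2 * (-1) ^ (i : ℕ) *
    Real.sqrt ((4 : ℝ) ^ α * l ^ (-2 * (1 + α)) * (l - node α l n i) * node α l n i *
      christoffel α l n i)

open Classical in
/-- The fundamental Lagrange interpolating polynomials in barycentric form.  At the nodes, where
the barycentric quotient is not defined, the values are those of its continuous extension. -/
def baryLagrange (α l : ℝ) (n : ℕ) (j : Fin (n + 1)) (x : ℝ) : ℝ :=
  if x = node α l n j then 1
  else if ∃ k, x = node α l n k then 0
  else (baryWeight α l n j / (x - node α l n j)) /
    ∑ k, baryWeight α l n k / (x - node α l n k)

/-- The `q`-th order barycentric shifted Gegenbauer integration matrix.  For `q = 1` its entries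
are the integrals over `[0, x i]` of the barycentric Lagrange polynomials; for `q ≥ 1` its `i`-th
row is the Hadamard product of the `i`-th row of the first-order matrix with the row of the numbers
`(x i - x j) ^ (q - 1)`, divided by `(q - 1)!`. -/
def intMatrix (α l : ℝ) (n q : ℕ) : Matrix (Fin (n + 1)) (Fin (n + 1)) ℝ :=
  Matrix.of fun i j =>
    (node α l n i - node α l n j) ^ (q - 1) / (Nat.factorial (q - 1) : ℝ) *
      ∫ x in (0 : ℝ)..(node α l n i), baryLagrange α l n j x

/-- The `q`-fold iterated integral of `f` from `0` to `x`. -/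
def iterIntegral (f : ℝ → ℝ) : ℕ → ℝ → ℝ
  | 0, x => f x
  | q + 1, x => ∫ σ in (0 : ℝ)..x, iterIntegral f q σ

/-- The truncation error, at the node `x i`, of the `q`-th order barycentric shifted Gegenbauer
quadrature of `f`: the exact `q`-fold integral minus its approximation by the quadrature. -/
def truncError (α l : ℝ) (n q : ℕ) (f : ℝ → ℝ) (i : Fin (n + 1)) : ℝ :=
  iterIntegral f q (node α l n i) -
    (intMatrix α l n q).mulVec (fun j => f (node α l n j)) i

end BSGQ

end

noncomputable section

namespace BSGQ

/-! ### Cauchy's formula for repeated integration -/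

/-! Put `g y = (x_i - y) ^ (q - 1) * f y`. By Cauchy's formula (`iterIntegral_succ_eq`) the exact
`q`-fold integral at `x_i` is the integral of `g` over `[0, x_i]` divided by `(q - 1)!`. The
barycentric functions are the true Lagrange basis polynomials of the nodes
(`baryLagrange_eq_eval_basis`), and the factors `(x_i - x_j) ^ (q - 1)` in the matrix turn the data
`f (x_j)` into `g (x_j)`. So the truncation error is the integral over `[0, x_i]` of the
interpolation error of `g`, divided by `(q - 1)!` (`truncError_eq_integral`).

Identifying the basis requires the barycentric weights to be one constant times the nodal weights `1
/ W'(x_j)`, with `W` the nodal polynomial. Orthogonality and the structure relations show that `(l -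
x_j) x_j ϖ_j` is a constant multiple of the squared nodal weight (`exists_christoffel_mul_eq`). The
square root gives the modulus, and the alternating sign matches that of the nodal weights of
increasing nodes.

Pointwise, the interpolation error is at most `A |W| / (n + 1)!` (`abs_sub_interpolate_le`), and `W`
is the shifted Gegenbauer polynomial over its leading coefficient. What remains is the maximum of
`|G_{n+1}|` on `[-1, 1]`, read off from the monotonicity of Sonin's function: it is attained at the
endpoints for `α ≥ 0`, while for `α < 0` it is controlled by the value or the slope at `0`. The
resulting bound is strict, because `W` vanishes at `x_i`. The asymptotic bounds come from Euler's
limit for Gamma and Stirling's lower bound for the factorial. -/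

/-- The definition splits off the outermost integral; the induction for Cauchy's formula needs to
split off the innermost one. -/
theorem iterIntegral_integral (f : ℝ → ℝ) (q : ℕ) :
    iterIntegral (fun y => ∫ t in (0 : ℝ)..y, f t) q = iterIntegral f (q + 1) := by
  induction q with
  | zero => rfl
  | succ q ih =>
    funext x
    rw [iterIntegral, ih]
    rfl

theorem iterIntegral_congr {f g : ℝ → ℝ} {l : ℝ} (h : Set.EqOn f g (Set.Icc 0 l)) (q : ℕ) :
    Set.EqOn (iterIntegral f q) (iterIntegral g q) (Set.Icc 0 l) := by
  induction q with
  | zero => exact h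
  | succ q ih =>
    intro x hx
    refine intervalIntegral.integral_congr fun y hy => ih ?_
    rw [Set.uIcc_of_le hx.1] at hy
    exact ⟨hy.1, hy.2.trans hx.2⟩

/-- Apply the induction hypothesis to the primitive of `f` and integrate by parts. Both boundary
terms vanish: the kernel at `y = x`, the primitive at `y = 0`. -/
theorem iterIntegral_succ_eq_of_continuous {f : ℝ → ℝ} (hf : Continuous f) (q : ℕ) (x : ℝ) :
    iterIntegral f (q + 1) x =
      ∫ y in (0 : ℝ)..x, (x - y) ^ q / (Nat.factorial q : ℝ) * f y := by
  induction q generalizing f with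
  | zero => simp [iterIntegral]
  | succ q ih =>
    have hF : Continuous fun y => ∫ t in (0 : ℝ)..y, f t :=
      intervalIntegral.continuous_primitive (fun a b => hf.intervalIntegrable a b) 0
    rw [← iterIntegral_integral, ih hF]
    have hu : ∀ y ∈ Set.uIcc 0 x, HasDerivAt
        (fun y => (x - y) ^ (q + 1) / (Nat.factorial (q + 1) : ℝ))
        (-((x - y) ^ q / (Nat.factorial q : ℝ))) y := by
      intro y _
      have h := ((((hasDerivAt_id y).const_sub x).pow (q + 1)).div_const
        (Nat.factorial (q + 1) : ℝ))
      refine h.congr_deriv ?_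
      have : (Nat.factorial q : ℝ) ≠ 0 := by positivity
      rw [Nat.factorial_succ]
      push_cast
      field_simp
      simp
    have hv : ∀ y ∈ Set.uIcc 0 x, HasDerivAt (fun y => ∫ t in (0 : ℝ)..y, f t) (f y) y :=
      fun y _ => intervalIntegral.integral_hasDerivAt_right (hf.intervalIntegrable _ _)
        hf.stronglyMeasurable.stronglyMeasurableAtFilter hf.continuousAt
    have h := intervalIntegral.integral_mul_deriv_eq_deriv_mul hu hv
      (Continuous.intervalIntegrable (by fun_prop) _ _) (hf.intervalIntegrable _ _)
    rw [h]
    simp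

/-- Both sides see `f` only on `[0, l]`, so `f` may be replaced by its continuous extension that is
constant outside the interval. -/
theorem iterIntegral_succ_eq {f : ℝ → ℝ} {l : ℝ} (hf : ContinuousOn f (Set.Icc 0 l)) (q : ℕ)
    {x : ℝ} (hx : x ∈ Set.Icc 0 l) :
    iterIntegral f (q + 1) x =
      ∫ y in (0 : ℝ)..x, (x - y) ^ q / (Nat.factorial q : ℝ) * f y := by
  have h0l : (0 : ℝ) ≤ l := hx.1.trans hx.2
  have hE : Set.EqOn f (Set.IccExtend h0l ((Set.Icc 0 l).domRestrict f)) (Set.Icc 0 l) := by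
    intro y hy
    rw [Set.IccExtend_of_mem h0l _ hy]
    rfl
  have hc : Continuous (Set.IccExtend h0l ((Set.Icc 0 l).domRestrict f)) :=
    hf.domRestrict.Icc_extend'
  rw [iterIntegral_congr hE (q + 1) hx, iterIntegral_succ_eq_of_continuous hc]
  refine intervalIntegral.integral_congr fun y hy => ?_
  rw [Set.uIcc_of_le hx.1] at hy
  rw [hE ⟨hy.1, hy.2.trans hx.2⟩]

/-! ### The error of polynomial interpolation -/

/-- Rolle's theorem for higher derivatives. -/
theorem exists_iteratedDerivWithin_eq_zero {a b : ℝ} (k : ℕ) {h : ℝ → ℝ}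
    (hh : ContDiffOn ℝ ((k + 1 : ℕ) : WithTop ℕ∞) h (Set.Icc a b))
    (z : Fin (k + 2) → ℝ) (hz : StrictMono z) (hzm : ∀ i, z i ∈ Set.Icc a b)
    (hz0 : ∀ i, h (z i) = 0) :
    ∃ ξ ∈ Set.Ioo a b, iteratedDerivWithin (k + 1) h (Set.Icc a b) ξ = 0 := by
  have rolle : ∀ {h : ℝ → ℝ}, ContinuousOn h (Set.Icc a b) → ∀ {u v : ℝ}, u ∈ Set.Icc a b →
      v ∈ Set.Icc a b → u < v → h u = 0 → h v = 0 →
      ∃ ξ ∈ Set.Ioo u v, ξ ∈ Set.Ioo a b ∧ derivWithin h (Set.Icc a b) ξ = 0 := by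
    intro h hc u v hu hv huv h1 h2
    obtain ⟨ξ, hξ, hd⟩ := exists_deriv_eq_zero huv (hc.mono (Set.Icc_subset_Icc hu.1 hv.2))
      (h1.trans h2.symm)
    have hξ' : ξ ∈ Set.Ioo a b := ⟨hu.1.trans_lt hξ.1, hξ.2.trans_le hv.2⟩
    exact ⟨ξ, hξ, hξ', by rw [derivWithin_of_mem_nhds (Icc_mem_nhds hξ'.1 hξ'.2), hd]⟩
  induction k generalizing h with
  | zero =>
    obtain ⟨ξ, -, hξ, hd⟩ := rolle hh.continuousOn (hzm 0) (hzm 1) (hz (by simp)) (hz0 0) (hz0 1)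
    exact ⟨ξ, hξ, by simpa [iteratedDerivWithin_one] using hd⟩
  | succ k ih =>
    have hab : a < b := (hzm 0).1.trans_lt ((hz (show (0 : Fin (k + 1 + 2)) < 1 by simp)).trans_le
      (hzm 1).2)
    -- One zero of the derivative in each gap between consecutive zeros; the gaps are disjoint and
    -- ordered, so the new zeros again increase strictly.
    choose ξ hξ hξm hξ0 using fun i : Fin (k + 2) =>
      rolle hh.continuousOn (hzm i.castSucc) (hzm i.succ) (hz i.castSucc_lt_succ)
        (hz0 _) (hz0 _)
    rw [iteratedDerivWithin_succ']
    refine ih (hh.derivWithin (uniqueDiffOn_Icc hab) (by norm_cast)) ξ ?_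
      (fun i => Set.Ioo_subset_Icc_self (hξm i)) hξ0
    intro i j hij
    exact (hξ i).2.trans_le ((hz.monotone (Fin.succ_le_castSucc_iff.2 hij)).trans (hξ j).1.le)

theorem contDiff_polynomial_eval (p : ℝ[X]) (n : WithTop ℕ∞) :
    ContDiff ℝ n (fun x => p.eval x) := by
  simpa [Polynomial.coe_aeval_eq_eval] using p.contDiff_aeval (𝕜 := ℝ) n

theorem iteratedDerivWithin_polynomial_eval (p : ℝ[X]) {s : Set ℝ} (hs : UniqueDiffOn ℝ s)
    {x : ℝ} (hx : x ∈ s) (k : ℕ) :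
    iteratedDerivWithin k (fun y => p.eval y) s x = (Polynomial.derivative^[k] p).eval x := by
  rw [iteratedDerivWithin_eq_iteratedDeriv hs (contDiff_polynomial_eval p _).contDiffAt hx,
    iteratedDeriv_eq_iterate]
  induction k generalizing p with
  | zero => rfl
  | succ k ih =>
    rw [Function.iterate_succ_apply, Function.iterate_succ_apply, ← ih]
    have hd : deriv (fun x => p.eval x) = fun x => (Polynomial.derivative p).eval x :=
      funext fun y => p.deriv
    rw [hd]

/-- Off the nodes, choose `c` so that `g - L - c W` vanishes at `y` as well as at the `n + 1` nodes.
Rolle then gives a zero `ξ` of its derivative of order `n + 1`; since `deg L ≤ n` and `W` is monic,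
the derivative of `g` at `ξ` is `(n + 1)! c`. As `ξ` is interior, a bound on the open interval
suffices. -/
theorem abs_sub_interpolate_le {a b A : ℝ} {n : ℕ} {g : ℝ → ℝ}
    (hg : ContDiffOn ℝ ((n + 1 : ℕ) : WithTop ℕ∞) g (Set.Icc a b))
    {v : Fin (n + 1) → ℝ} (hv : Function.Injective v) (hvm : ∀ i, v i ∈ Set.Icc a b)
    (hA : ∀ x ∈ Set.Ioo a b, |iteratedDerivWithin (n + 1) g (Set.Icc a b) x| ≤ A)
    {y : ℝ} (hy : y ∈ Set.Icc a b) :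
    |g y - (Lagrange.interpolate Finset.univ v (fun i => g (v i))).eval y| ≤
      A / (Nat.factorial (n + 1) : ℝ) * |(Lagrange.nodal Finset.univ v).eval y| := by
  set L := Lagrange.interpolate Finset.univ v (fun i => g (v i)) with hL
  set W := Lagrange.nodal Finset.univ v with hW
  by_cases hyv : ∃ i, y = v i
  · obtain ⟨i, rfl⟩ := hyv
    rw [hL, Lagrange.eval_interpolate_at_node _ hv.injOn (Finset.mem_univ i), hW,
      Lagrange.eval_nodal_at_node (Finset.mem_univ i)]
    simp
  push Not at hyv
  have hWy : W.eval y ≠ 0 := Lagrange.eval_nodal_not_at_node fun i _ => hyv i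
  set c := (g y - L.eval y) / W.eval y with hc
  set P := L + Polynomial.C c * W with hP
  have hPy : P.eval y = g y := by
    simp only [hP, hc, Polynomial.eval_add, Polynomial.eval_mul, Polynomial.eval_C]
    field_simp
    ring
  have hPv : ∀ i, P.eval (v i) = g (v i) := by
    intro i
    simp only [hP, Polynomial.eval_add, Polynomial.eval_mul, Polynomial.eval_C]
    rw [hL, Lagrange.eval_interpolate_at_node _ hv.injOn (Finset.mem_univ i), hW,
      Lagrange.eval_nodal_at_node (Finset.mem_univ i)]
    simp
  have hcard : (insert y (Finset.univ.image v)).card = n + 2 := by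
    rw [Finset.card_insert_of_notMem, Finset.card_image_of_injective _ hv]
    · simp
    · simpa using fun i => (hyv i).symm
  have hz : ∀ i, (insert y (Finset.univ.image v)).orderEmbOfFin hcard i ∈
      insert y (Finset.univ.image v) := fun i => Finset.orderEmbOfFin_mem _ hcard i
  have hab : a < b := by
    have h1 := hvm 0
    rcases lt_or_gt_of_ne (hyv 0) with h | h
    · exact (hy.1.trans_lt h).trans_le h1.2
    · exact (h1.1.trans_lt h).trans_le hy.2
  have hPc : ContDiffOn ℝ ((n + 1 : ℕ) : WithTop ℕ∞) (fun x => P.eval x) (Set.Icc a b) :=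
    (contDiff_polynomial_eval P _).contDiffOn
  obtain ⟨ξ, hξ, hξ0⟩ := exists_iteratedDerivWithin_eq_zero (a := a) (b := b) n
    (h := fun x => g x - P.eval x)
    (hg.sub hPc) ((insert y (Finset.univ.image v)).orderEmbOfFin hcard)
    (OrderEmbedding.strictMono _)
    (fun i => by
      rcases Finset.mem_insert.1 (hz i) with h | h
      · rw [h]; exact hy
      · obtain ⟨k, -, hk⟩ := Finset.mem_image.1 h
        rw [← hk]; exact hvm k)
    (fun i => by
      rcases Finset.mem_insert.1 (hz i) with h | h
      · rw [h, hPy, sub_self]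
      · obtain ⟨k, -, hk⟩ := Finset.mem_image.1 h
        rw [← hk, hPv, sub_self])
  have hξ' := Set.Ioo_subset_Icc_self hξ
  have huniq := uniqueDiffOn_Icc hab
  have hLdeg : L.degree < ((n + 1 : ℕ) : WithBot ℕ) := by
    have h := Lagrange.degree_interpolate_lt (s := Finset.univ) (fun i => g (v i)) hv.injOn
    rwa [Finset.card_univ, Fintype.card_fin] at h
  have hWdeg : W.natDegree = n + 1 := by simp [hW, Lagrange.natDegree_nodal]
  have hder : (Polynomial.derivative^[n + 1] P).eval ξ = (Nat.factorial (n + 1) : ℝ) * c := by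
    have hPdeg : P.natDegree ≤ n + 1 := by
      refine Polynomial.natDegree_add_le_of_degree_le
        (Polynomial.natDegree_le_of_degree_le hLdeg.le) ?_
      exact (Polynomial.natDegree_C_mul_le _ _).trans hWdeg.le
    have hcoef : P.coeff (n + 1) = c := by
      rw [hP, Polynomial.coeff_add, Polynomial.coeff_C_mul,
        Polynomial.coeff_eq_zero_of_degree_lt hLdeg, ← hWdeg, Polynomial.coeff_natDegree,
        (Lagrange.nodal_monic (s := Finset.univ) (v := v)).leadingCoeff]
      ring
    have h0 : (Polynomial.derivative^[n + 1] P).natDegree ≤ 0 :=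
      (Polynomial.natDegree_iterate_derivative P (n + 1)).trans (by omega)
    rw [Polynomial.eq_C_of_natDegree_le_zero h0, Polynomial.eval_C,
      Polynomial.coeff_iterate_derivative, zero_add, hcoef, Nat.descFactorial_self, nsmul_eq_mul]
  have hgξ : iteratedDerivWithin (n + 1) g (Set.Icc a b) ξ = (Nat.factorial (n + 1) : ℝ) * c := by
    have h := iteratedDerivWithin_sub (n := n + 1) hξ' huniq (hg ξ hξ') (hPc ξ hξ')
    erw [hξ0, iteratedDerivWithin_polynomial_eval P huniq hξ', hder] at h
    linarith
  have hcA : (Nat.factorial (n + 1) : ℝ) * |c| ≤ A := by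
    have h := hA ξ hξ
    rwa [hgξ, abs_mul, abs_of_pos (by positivity)] at h
  have hcA' : |c| ≤ A / (Nat.factorial (n + 1) : ℝ) := by
    rw [le_div_iff₀ (by positivity)]
    linarith
  have : g y - L.eval y = c * W.eval y := by
    rw [hc]
    field_simp
  rw [this, abs_mul]
  gcongr

/-! ### Weighted integrals of polynomials -/

/-- The integral of a polynomial over `[0, l]` for the weight `(x (l - x)) ^ (α - 1/2)`. -/
def wInt (α l : ℝ) (p : ℝ[X]) : ℝ :=
  ∫ x in (0 : ℝ)..l, (x * (l - x)) ^ (α - 1 / 2) * p.eval x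

section
variable {α l : ℝ}

/-- On the left half the weight is an integrable power of `x` times a continuous function; the right
half follows by the reflection `x ↦ l - x`. -/
theorem intervalIntegrable_weight (hα : -(1 / 2) < α) (hl : 0 < l) :
    IntervalIntegrable (fun x : ℝ => (x * (l - x)) ^ (α - 1 / 2)) MeasureTheory.volume 0 l := by
  have h1 : IntervalIntegrable (fun x : ℝ => (x * (l - x)) ^ (α - 1 / 2))
      MeasureTheory.volume 0 (l / 2) := by
    have h := (intervalIntegral.intervalIntegrable_rpow' (a := 0) (b := l / 2)
      (r := α - 1 / 2) (by linarith)).mul_continuousOn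
      (g := fun x => (l - x) ^ (α - 1 / 2)) (by
        refine ContinuousOn.rpow_const (by fun_prop) fun x hx => Or.inl ?_
        rw [Set.uIcc_of_le (by linarith)] at hx
        have := hx.2
        linarith)
    refine h.congr fun x hx => ?_
    rw [Set.uIoc_of_le (by linarith)] at hx
    exact (Real.mul_rpow hx.1.le (by linarith [hx.2])).symm
  refine h1.trans ?_
  have h2 := (h1.comp_sub_left l).symm
  rw [sub_zero, show l - l / 2 = l / 2 by ring] at h2
  refine h2.congr fun x _ => ?_
  congr 1
  ring

theorem intervalIntegrable_weight_mul (hα : -(1 / 2) < α) (hl : 0 < l) (p : ℝ[X]) :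
    IntervalIntegrable (fun x : ℝ => (x * (l - x)) ^ (α - 1 / 2) * p.eval x)
      MeasureTheory.volume 0 l :=
  (intervalIntegrable_weight hα hl).mul_continuousOn p.continuous.continuousOn

theorem wInt_add (hα : -(1 / 2) < α) (hl : 0 < l) (p q : ℝ[X]) :
    wInt α l (p + q) = wInt α l p + wInt α l q := by
  rw [wInt, wInt, wInt, ← intervalIntegral.integral_add (intervalIntegrable_weight_mul hα hl p)
    (intervalIntegrable_weight_mul hα hl q)]
  simp only [Polynomial.eval_add, mul_add]

theorem wInt_C_mul (c : ℝ) (p : ℝ[X]) :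
    wInt α l (Polynomial.C c * p) = c * wInt α l p := by
  rw [wInt, wInt, ← intervalIntegral.integral_const_mul]
  simp only [Polynomial.eval_mul, Polynomial.eval_C]
  congr 1
  funext x
  ring

theorem wInt_sub (hα : -(1 / 2) < α) (hl : 0 < l) (p q : ℝ[X]) :
    wInt α l (p - q) = wInt α l p - wInt α l q := by
  have h := wInt_add hα hl (p - q) q
  rw [sub_add_cancel] at h
  linarith

/-- The integrand is nonnegative and vanishes only at the finitely many roots of `p`. -/
theorem wInt_pos (hl : 0 < l) (hα : -(1 / 2) < α) {p : ℝ[X]} (hp : p ≠ 0)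
    (h0 : ∀ x ∈ Set.Ioo 0 l, 0 ≤ p.eval x) : 0 < wInt α l p := by
  have hpos : ∀ x ∈ Set.Ioo 0 l, 0 < (x * (l - x)) ^ (α - 1 / 2) := fun x hx =>
    Real.rpow_pos_of_pos (mul_pos hx.1 (sub_pos.2 hx.2)) _
  rw [wInt, intervalIntegral.integral_of_le hl.le, MeasureTheory.integral_Ioc_eq_integral_Ioo]
  have hint : MeasureTheory.IntegrableOn
      (fun x : ℝ => (x * (l - x)) ^ (α - 1 / 2) * p.eval x) (Set.Ioo 0 l) :=
    ((intervalIntegrable_iff_integrableOn_Ioo_of_le hl.le).1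
      (intervalIntegrable_weight_mul hα hl p))
  have hnn : 0 ≤ᵐ[MeasureTheory.volume.restrict (Set.Ioo 0 l)]
      fun x : ℝ => (x * (l - x)) ^ (α - 1 / 2) * p.eval x := by
    filter_upwards [MeasureTheory.ae_restrict_mem measurableSet_Ioo] with x hx
    exact mul_nonneg (hpos x hx).le (h0 x hx)
  rw [MeasureTheory.setIntegral_pos_iff_support_of_nonneg_ae hnn hint]
  have hsub : Set.Ioo 0 l \ (p.roots.toFinset : Set ℝ) ⊆
      Function.support (fun x : ℝ => (x * (l - x)) ^ (α - 1 / 2) * p.eval x) ∩ Set.Ioo 0 l := by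
    rintro x ⟨hx, hxr⟩
    refine ⟨mul_ne_zero (hpos x hx).ne' ?_, hx⟩
    simpa [hp, Polynomial.IsRoot] using hxr
  refine lt_of_lt_of_le ?_ (MeasureTheory.measure_mono hsub)
  rw [MeasureTheory.measure_sdiff_null (Finset.measure_zero _ _), Real.volume_Ioo]
  simpa using hl

/-- The derivative of `(x (l - x)) ^ (α + 1/2) p` has integral zero. -/
theorem wInt_derivative (hα : -(1 / 2) < α) (hl : 0 < l) (p : ℝ[X]) :
    wInt α l (Polynomial.X * (Polynomial.C l - Polynomial.X) * Polynomial.derivative p +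
      Polynomial.C (α + 1 / 2) * (Polynomial.C l - 2 * Polynomial.X) * p) = 0 := by
  have hcont : Continuous fun x : ℝ => (x * (l - x)) ^ (α + 1 / 2) * p.eval x :=
    (Continuous.rpow_const (by fun_prop) fun x => Or.inr (by linarith)).mul p.continuous
  have h := intervalIntegral.integral_eq_sub_of_hasDerivAt_of_le hl.le hcont.continuousOn
    (f' := fun x : ℝ => (x * (l - x)) ^ (α - 1 / 2) *
      (Polynomial.X * (Polynomial.C l - Polynomial.X) * Polynomial.derivative p +
      Polynomial.C (α + 1 / 2) * (Polynomial.C l - 2 * Polynomial.X) * p).eval x) ?_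
      (intervalIntegrable_weight_mul hα hl _)
  · rw [wInt, h]
    -- The boundary terms vanish because `α + 1/2 > 0`.
    simp [Real.zero_rpow (show α + 2⁻¹ ≠ 0 by linarith)]
  · intro x hx
    have hx0 : 0 < x * (l - x) := mul_pos hx.1 (sub_pos.2 hx.2)
    have h1 : HasDerivAt (fun x : ℝ => x * (l - x)) (1 * (l - x) + x * (-1)) x :=
      (hasDerivAt_id x).mul ((hasDerivAt_id x).const_sub l)
    have h2 := (h1.rpow_const (p := α + 1 / 2) (Or.inl hx0.ne')).mul (p.hasDerivAt x)
    refine h2.congr_deriv ?_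
    rw [show α + 1 / 2 = (α - 1 / 2) + 1 by ring, Real.rpow_add_one hx0.ne']
    simp only [Polynomial.eval_add, Polynomial.eval_mul, Polynomial.eval_sub, Polynomial.eval_X,
      Polynomial.eval_C, Polynomial.eval_ofNat]
    rw [show α - 1 / 2 + 1 - 1 = α - 1 / 2 by ring]
    ring

end

/-! ### Structure relations for Gegenbauer polynomials -/

section
variable {α : ℝ}

theorem gegenbauer_recurrence (hα : -(1 / 2) < α) (m : ℕ) :
    ((m : ℝ[X]) + 1 + 2 * Polynomial.C α) * gegenbauer α (m + 2) =
      2 * ((m : ℝ[X]) + 1 + Polynomial.C α) * Polynomial.X * gegenbauer α (m + 1) -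
        ((m : ℝ[X]) + 1) * gegenbauer α m := by
  have h : ((m : ℝ) + 1 + 2 * α) ≠ 0 := by
    have : (0 : ℝ) ≤ m := Nat.cast_nonneg m
    linarith
  have hC : ((m : ℝ[X]) + 1 + 2 * Polynomial.C α) * Polynomial.C (((m : ℝ) + 1 + 2 * α)⁻¹) = 1 := by
    have h2 : ((m : ℝ[X]) + 1 + 2 * Polynomial.C α) = Polynomial.C ((m : ℝ) + 1 + 2 * α) := by
      simp [Polynomial.C_ofNat]
    rw [h2, ← Polynomial.C_mul, mul_inv_cancel₀ h, Polynomial.C_1]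
  rw [gegenbauer, ← mul_assoc, hC]
  simp [Polynomial.C_ofNat]

theorem gegenbauer_coeff_ne_zero (hα : -(1 / 2) < α) (m : ℕ) :
    ((m : ℝ[X]) + 1 + 2 * Polynomial.C α) ≠ 0 := by
  have h2 : ((m : ℝ[X]) + 1 + 2 * Polynomial.C α) = Polynomial.C ((m : ℝ) + 1 + 2 * α) := by
    simp [Polynomial.C_ofNat]
  rw [h2, Ne, Polynomial.C_eq_zero]
  have : (0 : ℝ) ≤ m := Nat.cast_nonneg m
  linarith

/-- The two relations support each other in the induction: the first comes from the differentiated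
recurrence with both earlier relations inserted, the second from the earlier first relation plus the
recurrence itself. -/
theorem gegenbauer_structure (hα : -(1 / 2) < α) (m : ℕ) :
    (1 - Polynomial.X ^ 2) * Polynomial.derivative (gegenbauer α (m + 1)) =
      ((m : ℝ[X]) + 1) * (gegenbauer α m - Polynomial.X * gegenbauer α (m + 1)) ∧
    (1 - Polynomial.X ^ 2) * Polynomial.derivative (gegenbauer α m) =
      ((m : ℝ[X]) + 2 * Polynomial.C α) *
        (Polynomial.X * gegenbauer α m - gegenbauer α (m + 1)) := by
  induction m with
  | zero =>
    simp [gegenbauer]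
    ring
  | succ m ih =>
    obtain ⟨h1, h2⟩ := ih
    have hr := gegenbauer_recurrence hα m
    have hd := congrArg Polynomial.derivative hr
    simp only [Polynomial.derivative_mul, Polynomial.derivative_sub, Polynomial.derivative_add,
      Polynomial.derivative_natCast, Polynomial.derivative_one, Polynomial.derivative_C,
      Polynomial.derivative_ofNat, Polynomial.derivative_X] at hd
    constructor
    · apply mul_left_cancel₀ (gegenbauer_coeff_ne_zero hα m)
      push_cast
      linear_combination (1 - Polynomial.X ^ 2) * hd +
        2 * ((m : ℝ[X]) + 1 + Polynomial.C α) * Polynomial.X * h1 - ((m : ℝ[X]) + 1) * h2 +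
        ((m : ℝ[X]) + 2) * Polynomial.X * hr
    · push_cast
      linear_combination h1 + hr

theorem one_sub_X_sq_ne_zero : (1 - Polynomial.X ^ 2 : ℝ[X]) ≠ 0 := by
  intro h
  have := congrArg (Polynomial.eval 0) h
  simp at this

/-- The Gegenbauer differential equation. -/
theorem gegenbauer_ode (hα : -(1 / 2) < α) (m : ℕ) :
    (1 - Polynomial.X ^ 2) *
        Polynomial.derivative (Polynomial.derivative (gegenbauer α m)) -
      (2 * Polynomial.C α + 1) * Polynomial.X * Polynomial.derivative (gegenbauer α m) +
      (m : ℝ[X]) * ((m : ℝ[X]) + 2 * Polynomial.C α) * gegenbauer α m = 0 := by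
  cases m with
  | zero => simp [gegenbauer]
  | succ m =>
    obtain ⟨h1, -⟩ := gegenbauer_structure hα m
    obtain ⟨-, h2⟩ := gegenbauer_structure hα m
    have hd := congrArg Polynomial.derivative h1
    simp only [Polynomial.derivative_mul, Polynomial.derivative_sub, Polynomial.derivative_add,
      Polynomial.derivative_natCast, Polynomial.derivative_one,
      Polynomial.derivative_X, Polynomial.derivative_X_pow] at hd
    -- The differentiated first relation contains the derivative of the polynomial of lower degree;
    -- the extra factor `1 - X ^ 2` lets the second relation eliminate it.
    apply mul_left_cancel₀ one_sub_X_sq_ne_zero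
    push_cast at hd ⊢
    simp only [Polynomial.C_ofNat] at hd
    linear_combination (1 - Polynomial.X ^ 2) * hd + ((m : ℝ[X]) + 1) * h2 -
      (((m : ℝ[X]) + 2 * Polynomial.C α) * Polynomial.X) * h1

theorem gegenbauer_eval_one (hα : -(1 / 2) < α) (m : ℕ) : (gegenbauer α m).eval 1 = 1 := by
  induction m with
  | zero => simp [gegenbauer]
  | succ m ih =>
    have h := congrArg (Polynomial.eval 1) (gegenbauer_structure hα m).1
    simp only [Polynomial.eval_mul, Polynomial.eval_sub, Polynomial.eval_pow, Polynomial.eval_X,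
      Polynomial.eval_one, Polynomial.eval_add, Polynomial.eval_natCast, ih] at h
    have hm : (m : ℝ) + 1 ≠ 0 := by positivity
    have h' : ((m : ℝ) + 1) * (1 - (gegenbauer α (m + 1)).eval 1) = 0 := by linarith
    have := (mul_eq_zero.1 h').resolve_left hm
    linarith

theorem gegenbauer_eval_neg_one (hα : -(1 / 2) < α) (m : ℕ) :
    (gegenbauer α m).eval (-1) = (-1) ^ m := by
  induction m with
  | zero => simp [gegenbauer]
  | succ m ih =>
    have h := congrArg (Polynomial.eval (-1)) (gegenbauer_structure hα m).1
    simp only [Polynomial.eval_mul, Polynomial.eval_sub, Polynomial.eval_pow, Polynomial.eval_X,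
      Polynomial.eval_one, Polynomial.eval_add, Polynomial.eval_natCast, ih] at h
    have hm : (m : ℝ) + 1 ≠ 0 := by positivity
    have h' : ((m : ℝ) + 1) * ((-1) ^ m + (gegenbauer α (m + 1)).eval (-1)) = 0 := by linarith
    have := (mul_eq_zero.1 h').resolve_left hm
    rw [pow_succ]
    linarith

theorem gegenbauer_eval_zero_succ_succ (hα : -(1 / 2) < α) (m : ℕ) :
    (gegenbauer α (m + 2)).eval 0 =
      -(((m : ℝ) + 1) / ((m : ℝ) + 1 + 2 * α)) * (gegenbauer α m).eval 0 := by
  have h := congrArg (Polynomial.eval 0) (gegenbauer_recurrence hα m)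
  simp only [Polynomial.eval_mul, Polynomial.eval_sub, Polynomial.eval_X, Polynomial.eval_C,
    Polynomial.eval_one, Polynomial.eval_add, Polynomial.eval_natCast, Polynomial.eval_ofNat] at h
  have h0 : ((m : ℝ) + 1 + 2 * α) ≠ 0 := by
    have : (0 : ℝ) ≤ m := Nat.cast_nonneg m
    linarith
  field_simp
  linarith

theorem gegenbauer_eval_zero_of_odd (hα : -(1 / 2) < α) (k : ℕ) :
    (gegenbauer α (2 * k + 1)).eval 0 = 0 := by
  induction k with
  | zero => simp [gegenbauer]
  | succ k ih =>
    rw [show 2 * (k + 1) + 1 = (2 * k + 1) + 2 by ring, gegenbauer_eval_zero_succ_succ hα, ih,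
      mul_zero]

theorem gegenbauer_derivative_eval_zero (hα : -(1 / 2) < α) (m : ℕ) :
    (Polynomial.derivative (gegenbauer α (m + 1))).eval 0 =
      ((m : ℝ) + 1) * (gegenbauer α m).eval 0 := by
  have h := congrArg (Polynomial.eval 0) (gegenbauer_structure hα m).1
  simpa using h

theorem abs_gegenbauer_eval_zero (hα : -(1 / 2) < α) (k : ℕ) :
    |(gegenbauer α (2 * k)).eval 0| =
      ∏ j ∈ Finset.range k, (2 * (j : ℝ) + 1) / (2 * (j : ℝ) + 1 + 2 * α) := by
  induction k with
  | zero => simp [gegenbauer]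
  | succ k ih =>
    have h0 : 0 < (2 * (k : ℝ) + 1 + 2 * α) := by
      have : (0 : ℝ) ≤ k := Nat.cast_nonneg k
      linarith
    rw [show 2 * (k + 1) = 2 * k + 2 by ring, gegenbauer_eval_zero_succ_succ hα, abs_mul, ih,
      Finset.prod_range_succ, abs_neg, mul_comm]
    push_cast
    rw [abs_of_pos (by positivity)]

/-! ### Bounds by Sonin's function -/

/-- Sonin's function of a Gegenbauer polynomial. -/
def sonin (α : ℝ) (m : ℕ) (x : ℝ) : ℝ :=
  (gegenbauer α m).eval x ^ 2 + (1 - x ^ 2) *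
    (Polynomial.derivative (gegenbauer α m)).eval x ^ 2 / ((m : ℝ) * (m + 2 * α))

theorem eigenvalue_pos (hα : -(1 / 2) < α) {m : ℕ} (hm : m ≠ 0) :
    0 < (m : ℝ) * (m + 2 * α) := by
  have : (1 : ℝ) ≤ m := by exact_mod_cast Nat.one_le_iff_ne_zero.2 hm
  exact mul_pos (by linarith) (by linarith)

/-- The differential equation removes the second derivative, leaving a derivative with the sign of
`α x` wherever it is nonzero. Hence Sonin's function grows away from `0` for `α ≥ 0` and decays away
from `0` for `α < 0`. -/
theorem hasDerivAt_sonin (hα : -(1 / 2) < α) {m : ℕ} (hm : m ≠ 0) (x : ℝ) :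
    HasDerivAt (sonin α m) (4 * α * x *
      (Polynomial.derivative (gegenbauer α m)).eval x ^ 2 / ((m : ℝ) * (m + 2 * α))) x := by
  have hlam := eigenvalue_pos hα hm
  have h1 := (gegenbauer α m).hasDerivAt x
  have h2 := (Polynomial.derivative (gegenbauer α m)).hasDerivAt x
  have h := (h1.pow 2).add (((((hasDerivAt_id x).pow 2).const_sub 1).mul (h2.pow 2)).div_const
    ((m : ℝ) * (m + 2 * α)))
  refine h.congr_deriv ?_
  have ho := congrArg (Polynomial.eval x) (gegenbauer_ode hα m)
  simp only [Polynomial.eval_mul, Polynomial.eval_sub, Polynomial.eval_X, Polynomial.eval_C,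
    Polynomial.eval_one, Polynomial.eval_add, Polynomial.eval_natCast, Polynomial.eval_ofNat,
    Polynomial.eval_pow, Polynomial.eval_zero] at ho
  rw [eq_div_iff hlam.ne', add_mul, div_mul_cancel₀ _ hlam.ne']
  simp
  linear_combination 2 * (Polynomial.derivative (gegenbauer α m)).eval x * ho

theorem sq_gegenbauer_le_sonin (hα : -(1 / 2) < α) {m : ℕ} (hm : m ≠ 0) {x : ℝ}
    (hx : x ∈ Set.Icc (-1) 1) : (gegenbauer α m).eval x ^ 2 ≤ sonin α m x := by
  have : 0 ≤ 1 - x ^ 2 := by nlinarith [hx.1, hx.2]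
  have hlam := eigenvalue_pos hα hm
  exact le_add_of_nonneg_right (by positivity)

/-- Sonin's function dominates the square and is largest at `±1`, where it equals `1`. -/
theorem abs_gegenbauer_le_one (hα : 0 ≤ α) (m : ℕ) {x : ℝ} (hx : x ∈ Set.Icc (-1) 1) :
    |(gegenbauer α m).eval x| ≤ 1 := by
  rcases eq_or_ne m 0 with rfl | hm
  · simp [gegenbauer]
  have hα' : -(1 / 2) < α := by linarith
  have hlam := eigenvalue_pos hα' hm
  have hc : Continuous (sonin α m) :=
    continuous_iff_continuousAt.2 fun x => (hasDerivAt_sonin hα' hm x).continuousAt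
  suffices sonin α m x ≤ 1 by
    have := (sq_gegenbauer_le_sonin hα' hm hx).trans this
    exact (sq_le_one_iff_abs_le_one _).1 this
  rcases le_total 0 x with h0 | h0
  · have hmono : MonotoneOn (sonin α m) (Set.Icc 0 1) := by
      refine monotoneOn_of_deriv_nonneg (convex_Icc _ _) hc.continuousOn
        (fun y _ => (hasDerivAt_sonin hα' hm y).differentiableAt.differentiableWithinAt) ?_
      intro y hy
      rw [interior_Icc] at hy
      rw [(hasDerivAt_sonin hα' hm y).deriv]
      have := hy.1
      positivity
    refine (hmono ⟨h0, hx.2⟩ ⟨zero_le_one, le_rfl⟩ hx.2).trans ?_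
    simp [sonin, gegenbauer_eval_one hα']
  · have hanti : AntitoneOn (sonin α m) (Set.Icc (-1) 0) := by
      refine antitoneOn_of_deriv_nonpos (convex_Icc _ _) hc.continuousOn
        (fun y _ => (hasDerivAt_sonin hα' hm y).differentiableAt.differentiableWithinAt) ?_
      intro y hy
      rw [interior_Icc] at hy
      rw [(hasDerivAt_sonin hα' hm y).deriv]
      refine div_nonpos_of_nonpos_of_nonneg ?_ hlam.le
      exact mul_nonpos_of_nonpos_of_nonneg
        (mul_nonpos_of_nonneg_of_nonpos (by positivity) hy.2.le) (sq_nonneg _)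
    refine (hanti ⟨le_rfl, by norm_num⟩ ⟨hx.1, h0⟩ hx.1).trans ?_
    simp [sonin, gegenbauer_eval_neg_one hα', ← pow_mul, mul_comm m 2]

theorem sonin_le_sonin_zero (hα : -(1 / 2) < α) (hα0 : α < 0) {m : ℕ} (hm : m ≠ 0) {x : ℝ} :
    sonin α m x ≤ sonin α m 0 := by
  have hlam := eigenvalue_pos hα hm
  have hc : Continuous (sonin α m) :=
    continuous_iff_continuousAt.2 fun x => (hasDerivAt_sonin hα hm x).continuousAt
  rcases le_total 0 x with h0 | h0
  · have hanti : AntitoneOn (sonin α m) (Set.Ici 0) := by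
      refine antitoneOn_of_deriv_nonpos (convex_Ici _) hc.continuousOn
        (fun y _ => (hasDerivAt_sonin hα hm y).differentiableAt.differentiableWithinAt) ?_
      intro y hy
      rw [interior_Ici] at hy
      rw [(hasDerivAt_sonin hα hm y).deriv]
      refine div_nonpos_of_nonpos_of_nonneg ?_ hlam.le
      have hy' : 0 < y := hy
      exact mul_nonpos_of_nonpos_of_nonneg
        (mul_nonpos_of_nonpos_of_nonneg (by linarith) hy'.le) (sq_nonneg _)
    exact hanti Set.self_mem_Ici h0 h0
  · have hmono : MonotoneOn (sonin α m) (Set.Iic 0) := by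
      refine monotoneOn_of_deriv_nonneg (convex_Iic _) hc.continuousOn
        (fun y _ => (hasDerivAt_sonin hα hm y).differentiableAt.differentiableWithinAt) ?_
      intro y hy
      rw [interior_Iic] at hy
      rw [(hasDerivAt_sonin hα hm y).deriv]
      refine div_nonneg ?_ hlam.le
      have hy' : y < 0 := hy
      exact mul_nonneg (mul_nonneg_of_nonpos_of_nonpos (by linarith) hy'.le) (sq_nonneg _)
    exact hmono h0 Set.self_mem_Iic h0

/-- In even degree the slope at `0` vanishes, so the maximum of Sonin's function is the square of
the central value. Degree `0` is left out because Sonin's function divides by the eigenvalue. -/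
theorem abs_gegenbauer_even_le (hα : -(1 / 2) < α) (hα0 : α < 0) (k : ℕ) {x : ℝ}
    (hx : x ∈ Set.Icc (-1) 1) :
    |(gegenbauer α (2 * (k + 1))).eval x| ≤ |(gegenbauer α (2 * (k + 1))).eval 0| := by
  have hm : 2 * (k + 1) ≠ 0 := by omega
  have h := (sq_gegenbauer_le_sonin hα hm hx).trans (sonin_le_sonin_zero hα hα0 hm)
  rw [← sq_le_sq]
  refine h.trans_eq ?_
  rw [sonin, show 2 * (k + 1) = (2 * k + 1) + 1 by ring, gegenbauer_derivative_eval_zero hα,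
    gegenbauer_eval_zero_of_odd hα]
  simp

/-- In odd degree the central value vanishes, so only the slope term of Sonin's function at `0`
survives; the structure relation expresses that slope by the central value one degree lower. -/
theorem abs_gegenbauer_odd_le (hα : -(1 / 2) < α) (hα0 : α < 0) (k : ℕ) {x : ℝ}
    (hx : x ∈ Set.Icc (-1) 1) :
    |(gegenbauer α (2 * k + 1)).eval x| ≤ (2 * (k : ℝ) + 1) * |(gegenbauer α (2 * k)).eval 0| /
      Real.sqrt ((2 * (k : ℝ) + 1) * (2 * k + 1 + 2 * α)) := by
  have hm : 2 * k + 1 ≠ 0 := by omega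
  have hlam := eigenvalue_pos hα hm
  push_cast at hlam
  have h := (sq_gegenbauer_le_sonin hα hm hx).trans (sonin_le_sonin_zero hα hα0 hm)
  refine abs_le_of_sq_le_sq (h.trans_eq ?_) (by positivity)
  rw [sonin, gegenbauer_derivative_eval_zero hα, gegenbauer_eval_zero_of_odd hα, div_pow,
    Real.sq_sqrt hlam.le, mul_pow, mul_pow, sq_abs]
  push_cast
  ring

/-! ### Leading coefficients -/

theorem natDegree_gegenbauer_le (α : ℝ) (m : ℕ) : (gegenbauer α m).natDegree ≤ m := by
  induction m using Nat.twoStepInduction with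
  | zero => simp [gegenbauer]
  | one => simp [gegenbauer]
  | more m ih1 ih2 =>
    rw [gegenbauer]
    refine (Polynomial.natDegree_C_mul_le _ _).trans ?_
    refine (Polynomial.natDegree_sub_le _ _).trans (max_le ?_ ?_)
    · rw [mul_assoc]
      refine (Polynomial.natDegree_C_mul_le _ _).trans ?_
      refine Polynomial.natDegree_mul_le.trans ?_
      rw [Polynomial.natDegree_X]
      omega
    · exact (Polynomial.natDegree_C_mul_le _ _).trans (by omega)

/-- The leading coefficient of the Gegenbauer polynomial of degree `m + 1`. -/
def gegenbauerLead (α : ℝ) (m : ℕ) : ℝ :=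
  2 ^ m * Real.Gamma (m + α + 1) * Real.Gamma (2 * α + 1) /
    (Real.Gamma (α + 1) * Real.Gamma (m + 2 * α + 1))

theorem gegenbauerLead_pos (hα : -(1 / 2) < α) (m : ℕ) : 0 < gegenbauerLead α m := by
  have hm : (0 : ℝ) ≤ m := Nat.cast_nonneg m
  have h1 := Real.Gamma_pos_of_pos (show 0 < m + α + 1 by linarith)
  have h2 := Real.Gamma_pos_of_pos (show 0 < 2 * α + 1 by linarith)
  have h3 := Real.Gamma_pos_of_pos (show 0 < α + 1 by linarith)
  have h4 := Real.Gamma_pos_of_pos (show 0 < m + 2 * α + 1 by linarith)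
  rw [gegenbauerLead]
  positivity

theorem gegenbauerLead_succ (hα : -(1 / 2) < α) (m : ℕ) :
    gegenbauerLead α (m + 1) =
      ((m : ℝ) + 1 + 2 * α)⁻¹ * (2 * ((m : ℝ) + 1 + α)) * gegenbauerLead α m := by
  have hm : (0 : ℝ) ≤ m := Nat.cast_nonneg m
  have h3 := Real.Gamma_pos_of_pos (show 0 < α + 1 by linarith)
  have h4 := Real.Gamma_pos_of_pos (show 0 < m + 2 * α + 1 by linarith)
  rw [gegenbauerLead, gegenbauerLead]
  push_cast
  rw [show (m : ℝ) + 1 + α + 1 = (m + α + 1) + 1 by ring,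
    Real.Gamma_add_one (show (m : ℝ) + α + 1 ≠ 0 by linarith),
    show (m : ℝ) + 1 + 2 * α + 1 = (m + 2 * α + 1) + 1 by ring,
    Real.Gamma_add_one (show (m : ℝ) + 2 * α + 1 ≠ 0 by linarith),
    show (m : ℝ) + 1 + 2 * α = m + 2 * α + 1 by ring]
  have h5 : (m : ℝ) + 2 * α + 1 ≠ 0 := by linarith
  field_simp
  ring

theorem coeff_gegenbauer (hα : -(1 / 2) < α) (m : ℕ) :
    (gegenbauer α (m + 1)).coeff (m + 1) = gegenbauerLead α m := by
  induction m with
  | zero =>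
    have h3 := Real.Gamma_pos_of_pos (show 0 < α + 1 by linarith)
    have h4 := Real.Gamma_pos_of_pos (show 0 < 2 * α + 1 by linarith)
    simp [gegenbauer, gegenbauerLead, h3.ne', h4.ne']
  | succ m ih =>
    rw [gegenbauer, gegenbauerLead_succ hα, Polynomial.coeff_C_mul, Polynomial.coeff_sub,
      mul_assoc, Polynomial.coeff_C_mul, Polynomial.coeff_X_mul, ih, Polynomial.coeff_C_mul,
      Polynomial.coeff_eq_zero_of_natDegree_lt
        ((natDegree_gegenbauer_le α m).trans_lt (by omega))]
    ring

theorem natDegree_gegenbauer (hα : -(1 / 2) < α) (m : ℕ) : (gegenbauer α m).natDegree = m := by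
  cases m with
  | zero => simp [gegenbauer]
  | succ m =>
    refine Polynomial.natDegree_eq_of_le_of_coeff_ne_zero (natDegree_gegenbauer_le α _) ?_
    rw [coeff_gegenbauer hα]
    exact (gegenbauerLead_pos hα m).ne'

end

/-! ### Shifted Gegenbauer polynomials -/

section
variable {α l : ℝ}

theorem shift_natDegree (hl : 0 < l) :
    (Polynomial.C (2 / l) * Polynomial.X - 1 : ℝ[X]).natDegree = 1 := by
  have h := Polynomial.natDegree_linear (a := 2 / l) (b := -1) (by positivity)
  simpa [sub_eq_add_neg] using h

theorem shift_leadingCoeff (hl : 0 < l) :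
    (Polynomial.C (2 / l) * Polynomial.X - 1 : ℝ[X]).leadingCoeff = 2 / l := by
  have h := Polynomial.leadingCoeff_linear (a := 2 / l) (b := -1) (by positivity)
  simpa [sub_eq_add_neg] using h

theorem natDegree_shiftedGegenbauer (hα : -(1 / 2) < α) (hl : 0 < l) (m : ℕ) :
    (shiftedGegenbauer α l m).natDegree = m := by
  rw [shiftedGegenbauer, Polynomial.natDegree_comp, shift_natDegree hl,
    natDegree_gegenbauer hα, mul_one]

theorem leadingCoeff_shiftedGegenbauer (hα : -(1 / 2) < α) (hl : 0 < l) (n : ℕ) :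
    (shiftedGegenbauer α l (n + 1)).leadingCoeff = gegenbauerLead α n * (2 / l) ^ (n + 1) := by
  rw [shiftedGegenbauer, Polynomial.leadingCoeff_comp (by rw [shift_natDegree hl]; simp),
    shift_leadingCoeff hl, natDegree_gegenbauer hα, Polynomial.leadingCoeff,
    natDegree_gegenbauer hα, coeff_gegenbauer hα]

theorem leadingCoeff_shiftedGegenbauer_pos (hα : -(1 / 2) < α) (hl : 0 < l) (m : ℕ) :
    0 < (shiftedGegenbauer α l m).leadingCoeff := by
  cases m with
  | zero => simp [shiftedGegenbauer, gegenbauer]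
  | succ n =>
    rw [leadingCoeff_shiftedGegenbauer hα hl]
    have := gegenbauerLead_pos hα n
    positivity

theorem shiftedGegenbauer_ne_zero (hα : -(1 / 2) < α) (hl : 0 < l) (m : ℕ) :
    shiftedGegenbauer α l m ≠ 0 :=
  Polynomial.leadingCoeff_ne_zero.1 (leadingCoeff_shiftedGegenbauer_pos hα hl m).ne'

theorem eval_shiftedGegenbauer (α l : ℝ) (m : ℕ) (x : ℝ) :
    (shiftedGegenbauer α l m).eval x = (gegenbauer α m).eval (2 / l * x - 1) := by
  simp [shiftedGegenbauer, Polynomial.eval_comp]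

theorem derivative_shiftedGegenbauer (α l : ℝ) (m : ℕ) :
    Polynomial.derivative (shiftedGegenbauer α l m) = Polynomial.C (2 / l) *
      (Polynomial.derivative (gegenbauer α m)).comp (Polynomial.C (2 / l) * Polynomial.X - 1) := by
  simp [shiftedGegenbauer, Polynomial.derivative_comp]

theorem shiftedGegenbauer_ode (hα : -(1 / 2) < α) (hl : 0 < l) (m : ℕ) :
    Polynomial.X * (Polynomial.C l - Polynomial.X) *
        Polynomial.derivative (Polynomial.derivative (shiftedGegenbauer α l m)) +
      Polynomial.C (α + 1 / 2) * (Polynomial.C l - 2 * Polynomial.X) *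
        Polynomial.derivative (shiftedGegenbauer α l m) +
      Polynomial.C ((m : ℝ) * (m + 2 * α)) * shiftedGegenbauer α l m = 0 := by
  have h := congrArg (fun p => p.comp (Polynomial.C (2 / l) * Polynomial.X - 1))
    (gegenbauer_ode hα m)
  simp only [Polynomial.add_comp, Polynomial.sub_comp, Polynomial.mul_comp, Polynomial.X_comp,
    Polynomial.C_comp, Polynomial.one_comp, Polynomial.natCast_comp, Polynomial.ofNat_comp,
    Polynomial.zero_comp, Polynomial.pow_comp] at h
  have h2 : Polynomial.derivative (Polynomial.derivative (shiftedGegenbauer α l m)) =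
      Polynomial.C (2 / l) ^ 2 * (Polynomial.derivative (Polynomial.derivative
        (gegenbauer α m))).comp (Polynomial.C (2 / l) * Polynomial.X - 1) := by
    rw [derivative_shiftedGegenbauer]
    simp [Polynomial.derivative_comp]
    ring
  have hcl : Polynomial.C (2 / l) * Polynomial.C l = (2 : ℝ[X]) := by
    rw [← Polynomial.C_mul, div_mul_cancel₀ _ hl.ne', Polynomial.C_ofNat]
  have hb : 2 * Polynomial.C (α + 1 / 2) = 2 * Polynomial.C α + 1 := by
    rw [← Polynomial.C_ofNat, ← Polynomial.C_1, ← Polynomial.C_mul, ← Polynomial.C_mul,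
      ← Polynomial.C_add]
    congr 1
    ring
  rw [h2, derivative_shiftedGegenbauer]
  have hlam : Polynomial.C ((m : ℝ) * (m + 2 * α)) =
      (m : ℝ[X]) * ((m : ℝ[X]) + 2 * Polynomial.C α) := by
    simp [Polynomial.C_ofNat]
  rw [hlam]
  simp only [shiftedGegenbauer]
  set D2 := (Polynomial.derivative (Polynomial.derivative (gegenbauer α m))).comp
    (Polynomial.C (2 / l) * Polynomial.X - 1)
  set D1 := (Polynomial.derivative (gegenbauer α m)).comp
    (Polynomial.C (2 / l) * Polynomial.X - 1)
  linear_combination h + (D2 * Polynomial.C (2 / l) * Polynomial.X +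
    D1 * Polynomial.C (α + 1 / 2)) * hcl + D1 * (1 - Polynomial.C (2 / l) * Polynomial.X) * hb

/-! ### Orthogonality -/

/-- Test the differential equation against `q` and integrate by parts. The right side is symmetric
in the two derivatives, so the operator is self-adjoint for the weight. -/
theorem eigenvalue_mul_wInt (hα : -(1 / 2) < α) (hl : 0 < l) (m : ℕ) (q : ℝ[X]) :
    ((m : ℝ) * (m + 2 * α)) * wInt α l (shiftedGegenbauer α l m * q) =
      wInt α l (Polynomial.X * (Polynomial.C l - Polynomial.X) *
        (Polynomial.derivative (shiftedGegenbauer α l m) * Polynomial.derivative q)) := by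
  have h := wInt_derivative hα hl (Polynomial.derivative (shiftedGegenbauer α l m) * q)
  have ho := shiftedGegenbauer_ode hα hl m
  rw [← wInt_C_mul, ← sub_eq_zero, ← wInt_sub hα hl, ← neg_eq_zero, ← h, ← neg_one_mul,
    ← wInt_C_mul]
  congr 1
  rw [Polynomial.derivative_mul, Polynomial.C_neg, Polynomial.C_1]
  linear_combination - q * ho

/-- Eigenfunctions for distinct eigenvalues are orthogonal. The eigenvalues differ by `(m - k) (m +
k + 2 α)`, nonzero since `m + k ≥ 1` and `2 α > -1`. -/
theorem wInt_mul_shiftedGegenbauer (hα : -(1 / 2) < α) (hl : 0 < l) {m k : ℕ} (hk : k < m) :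
    wInt α l (shiftedGegenbauer α l m * shiftedGegenbauer α l k) = 0 := by
  have h1 := eigenvalue_mul_wInt hα hl m (shiftedGegenbauer α l k)
  have h2 := eigenvalue_mul_wInt hα hl k (shiftedGegenbauer α l m)
  rw [mul_comm (Polynomial.derivative (shiftedGegenbauer α l k)), ← h1,
    mul_comm (shiftedGegenbauer α l k)] at h2
  have hkm : (k : ℝ) + 1 ≤ m := by exact_mod_cast hk
  have hk0 : (0 : ℝ) ≤ k := Nat.cast_nonneg k
  have h3 : (((m : ℝ) - k) * (m + k + 2 * α)) *
      wInt α l (shiftedGegenbauer α l m * shiftedGegenbauer α l k) = 0 := by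
    linear_combination -h2
  refine (mul_eq_zero.1 h3).resolve_left (mul_ne_zero ?_ ?_)
  · linarith
  · linarith

theorem wInt_shiftedGegenbauer_mul (hα : -(1 / 2) < α) (hl : 0 < l) {m : ℕ} {q : ℝ[X]}
    (hq : q.degree < m) : wInt α l (shiftedGegenbauer α l m * q) = 0 := by
  suffices ∀ k ≤ m, ∀ q : ℝ[X], q.degree < k → wInt α l (shiftedGegenbauer α l m * q) = 0 from
    this m le_rfl q hq
  intro k
  induction k with
  | zero =>
    intro _ q hq
    have : q = 0 := by simpa using hq
    simp [this, wInt]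
  | succ k ih =>
    intro hk q hq
    set c := q.coeff k / (shiftedGegenbauer α l k).leadingCoeff
    have hlc := leadingCoeff_shiftedGegenbauer_pos hα hl k
    have hdeg : (q - Polynomial.C c * shiftedGegenbauer α l k).degree < k := by
      rw [Polynomial.degree_lt_iff_coeff_zero] at hq ⊢
      intro j hj
      rw [Polynomial.coeff_sub, Polynomial.coeff_C_mul]
      rcases hj.eq_or_lt with rfl | hj
      · rw [Polynomial.leadingCoeff, natDegree_shiftedGegenbauer hα hl] at hlc
        simp only [c, Polynomial.leadingCoeff, natDegree_shiftedGegenbauer hα hl]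
        rw [div_mul_cancel₀ _ hlc.ne', sub_self]
      · rw [hq j hj, Polynomial.coeff_eq_zero_of_natDegree_lt
          (by rwa [natDegree_shiftedGegenbauer hα hl])]
        simp
    have h1 := ih (by omega) _ hdeg
    have h2 : shiftedGegenbauer α l m * q =
        shiftedGegenbauer α l m * (q - Polynomial.C c * shiftedGegenbauer α l k) +
          Polynomial.C c * (shiftedGegenbauer α l m * shiftedGegenbauer α l k) := by ring
    rw [h2, wInt_add hα hl, h1, wInt_C_mul, wInt_mul_shiftedGegenbauer hα hl (by omega)]
    simp

/-! ### The nodes -/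

/-- Away from `±1`, the structure relations carry a common zero of the polynomial and its derivative
down one degree, and eventually to the constant `1`. -/
theorem gegenbauer_simple_zero (hα : -(1 / 2) < α) {t : ℝ} (ht : 1 - t ^ 2 ≠ 0) (m : ℕ) :
    (gegenbauer α m).eval t = 0 → (Polynomial.derivative (gegenbauer α m)).eval t ≠ 0 := by
  induction m with
  | zero => simp [gegenbauer]
  | succ m ih =>
    intro h0 h1
    obtain ⟨hs1, hs2⟩ := gegenbauer_structure hα m
    replace hs1 := congrArg (Polynomial.eval t) hs1
    replace hs2 := congrArg (Polynomial.eval t) hs2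
    simp only [Polynomial.eval_mul, Polynomial.eval_sub, Polynomial.eval_pow, Polynomial.eval_X,
      Polynomial.eval_one, Polynomial.eval_add, Polynomial.eval_natCast, h0, h1, mul_zero,
      sub_zero] at hs1 hs2
    have hm : (m : ℝ) + 1 ≠ 0 := by positivity
    have h2 : (gegenbauer α m).eval t = 0 := (mul_eq_zero.1 hs1.symm).resolve_left hm
    rw [h2, mul_zero, mul_zero] at hs2
    exact ih h2 ((mul_eq_zero.1 hs2).resolve_left ht)

theorem one_sub_shift_sq (hl : 0 < l) (x : ℝ) :
    1 - (2 / l * x - 1) ^ 2 = 4 / l ^ 2 * (x * (l - x)) := by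
  field_simp
  ring

theorem shiftedGegenbauer_simple_zero (hα : -(1 / 2) < α) (hl : 0 < l) {x : ℝ}
    (hx : x ∈ Set.Ioo 0 l) (m : ℕ) (h0 : (shiftedGegenbauer α l m).eval x = 0) :
    (Polynomial.derivative (shiftedGegenbauer α l m)).eval x ≠ 0 := by
  rw [eval_shiftedGegenbauer] at h0
  rw [derivative_shiftedGegenbauer, Polynomial.eval_mul, Polynomial.eval_C, Polynomial.eval_comp]
  refine mul_ne_zero (by positivity) ?_
  simp only [Polynomial.eval_sub, Polynomial.eval_mul, Polynomial.eval_C, Polynomial.eval_X,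
    Polynomial.eval_one]
  refine gegenbauer_simple_zero hα ?_ m h0
  rw [one_sub_shift_sq hl]
  have := mul_pos hx.1 (sub_pos.2 hx.2)
  positivity

theorem constant_sign_of_forall_ne_zero {s : Set ℝ} (hs : IsPreconnected s) {f : ℝ → ℝ}
    (hf : ContinuousOn f s) (h0 : ∀ x ∈ s, f x ≠ 0) :
    (∀ x ∈ s, 0 ≤ f x) ∨ ∀ x ∈ s, 0 ≤ -f x := by
  by_contra! h
  obtain ⟨⟨x, hx, hx0⟩, y, hy, hy0⟩ := h
  obtain ⟨z, hz, hz0⟩ := hs.intermediate_value hx hy hf ⟨hx0.le, by linarith⟩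
  exact h0 z hz hz0

open Classical in
-- Suppose there are fewer than `m` distinct roots in the interval, and let `P` be the product of
-- their linear factors. Then `p` is orthogonal to `P`. But `p = P t`, and simplicity of the roots
-- keeps `t` from vanishing inside, so `p P = P ^ 2 t` has constant sign and nonzero integral.
theorem card_filter_roots (hα : -(1 / 2) < α) (hl : 0 < l) (m : ℕ) :
    m ≤ ((shiftedGegenbauer α l m).roots.toFinset.filter (· ∈ Set.Ioo 0 l)).card := by
  set p := shiftedGegenbauer α l m with hp
  set R := p.roots.toFinset.filter (· ∈ Set.Ioo 0 l) with hR
  have hp0 : p ≠ 0 := shiftedGegenbauer_ne_zero hα hl m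
  by_contra! hlt
  set P : ℝ[X] := (R.val.map fun a => Polynomial.X - Polynomial.C a).prod with hP
  have hdvd : P ∣ p := by
    rw [hP, Multiset.prod_X_sub_C_dvd_iff_le_roots hp0, Multiset.le_iff_subset R.nodup]
    intro r hr
    exact Multiset.mem_toFinset.1 (Finset.mem_filter.1 hr).1
  have hPdeg : P.natDegree = R.card := Polynomial.natDegree_multiset_prod_X_sub_C_eq_card _
  obtain ⟨t, ht⟩ := hdvd
  have ht0 : ∀ x ∈ Set.Ioo 0 l, t.eval x ≠ 0 := by
    intro x hx h0
    have hpx : p.eval x = 0 := by rw [ht, Polynomial.eval_mul, h0, mul_zero]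
    have hxR : x ∈ R := by
      rw [hR, Finset.mem_filter, Multiset.mem_toFinset, Polynomial.mem_roots hp0]
      exact ⟨hpx, hx⟩
    have hPx : P.eval x = 0 := by
      rw [hP, Polynomial.eval_multiset_prod, Multiset.prod_eq_zero]
      rw [Multiset.map_map, Multiset.mem_map]
      exact ⟨x, hxR, by simp⟩
    refine shiftedGegenbauer_simple_zero hα hl hx m hpx ?_
    rw [← hp, ht, Polynomial.derivative_mul]
    simp [h0, hPx]
  have hPd : P.degree < m := by
    refine Polynomial.degree_le_natDegree.trans_lt ?_
    rw [hPdeg]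
    exact_mod_cast hlt
  have horth := wInt_shiftedGegenbauer_mul hα hl hPd
  have hP0 : P ≠ 0 := left_ne_zero_of_mul (ht ▸ hp0)
  have hpP : p * P ≠ 0 := mul_ne_zero hp0 hP0
  have heval : ∀ x, (p * P).eval x = P.eval x ^ 2 * t.eval x := by
    intro x
    rw [Polynomial.eval_mul, ht, Polynomial.eval_mul]
    ring
  rcases constant_sign_of_forall_ne_zero isPreconnected_Ioo t.continuous.continuousOn ht0 with h | h
  · refine (wInt_pos hl hα hpP fun x hx => ?_).ne' horth
    rw [heval]
    exact mul_nonneg (sq_nonneg _) (h x hx)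
  · refine (wInt_pos hl hα (neg_ne_zero.2 hpP) fun x hx => ?_).ne' ?_
    · rw [Polynomial.eval_neg, heval, ← mul_neg]
      exact mul_nonneg (sq_nonneg _) (h x hx)
    · rw [← neg_one_mul, ← Polynomial.C_1, ← Polynomial.C_neg, wInt_C_mul, horth, mul_zero]

theorem card_roots_toFinset_shiftedGegenbauer (hα : -(1 / 2) < α) (hl : 0 < l) (m : ℕ) :
    (shiftedGegenbauer α l m).roots.toFinset.card = m ∧
      ∀ x ∈ (shiftedGegenbauer α l m).roots.toFinset, x ∈ Set.Ioo 0 l := by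
  classical
  have h1 := card_filter_roots hα hl m
  have h2 : (shiftedGegenbauer α l m).roots.toFinset.card ≤ m :=
    (Multiset.toFinset_card_le _).trans ((Polynomial.card_roots' _).trans
      (natDegree_shiftedGegenbauer hα hl m).le)
  have h3 := Finset.card_filter_le (shiftedGegenbauer α l m).roots.toFinset (· ∈ Set.Ioo 0 l)
  have h4 := Finset.eq_of_subset_of_card_le (Finset.filter_subset (· ∈ Set.Ioo 0 l)
    (shiftedGegenbauer α l m).roots.toFinset) (h2.trans h1)
  refine ⟨by omega, fun x hx => ?_⟩
  rw [← h4] at hx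
  exact (Finset.mem_filter.1 hx).2

theorem node_eq_getElem (hα : -(1 / 2) < α) (hl : 0 < l) (n : ℕ) (i : Fin (n + 1)) :
    ∃ h : (i : ℕ) < ((shiftedGegenbauer α l (n + 1)).roots.toFinset.sort (· ≤ ·)).length,
      node α l n i = ((shiftedGegenbauer α l (n + 1)).roots.toFinset.sort (· ≤ ·))[(i : ℕ)] := by
  have h : (i : ℕ) < ((shiftedGegenbauer α l (n + 1)).roots.toFinset.sort (· ≤ ·)).length := by
    rw [Finset.length_sort, (card_roots_toFinset_shiftedGegenbauer hα hl (n + 1)).1]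
    exact i.2
  exact ⟨h, List.getD_eq_getElem _ _ h⟩

theorem node_mem_roots (hα : -(1 / 2) < α) (hl : 0 < l) (n : ℕ) (i : Fin (n + 1)) :
    node α l n i ∈ (shiftedGegenbauer α l (n + 1)).roots.toFinset := by
  obtain ⟨h, he⟩ := node_eq_getElem hα hl n i
  rw [he, ← Finset.mem_sort (· ≤ ·)]
  exact List.getElem_mem h

theorem node_mem_Ioo (hα : -(1 / 2) < α) (hl : 0 < l) (n : ℕ) (i : Fin (n + 1)) :
    node α l n i ∈ Set.Ioo 0 l :=
  (card_roots_toFinset_shiftedGegenbauer hα hl (n + 1)).2 _ (node_mem_roots hα hl n i)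

theorem eval_node (hα : -(1 / 2) < α) (hl : 0 < l) (n : ℕ) (i : Fin (n + 1)) :
    (shiftedGegenbauer α l (n + 1)).eval (node α l n i) = 0 :=
  (Polynomial.mem_roots'.1 (Multiset.mem_toFinset.1 (node_mem_roots hα hl n i))).2

theorem strictMono_node (hα : -(1 / 2) < α) (hl : 0 < l) (n : ℕ) : StrictMono (node α l n) := by
  intro i j hij
  obtain ⟨hi, hie⟩ := node_eq_getElem hα hl n i
  obtain ⟨hj, hje⟩ := node_eq_getElem hα hl n j
  rw [hie, hje]
  exact (Finset.sortedLT_sort _).strictMono_get (a := ⟨i, hi⟩) (b := ⟨j, hj⟩) hij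

theorem shiftedGegenbauer_eq_nodal (hα : -(1 / 2) < α) (hl : 0 < l) (n : ℕ) :
    shiftedGegenbauer α l (n + 1) =
      Polynomial.C (shiftedGegenbauer α l (n + 1)).leadingCoeff *
        Lagrange.nodal Finset.univ (node α l n) := by
  have hK := (leadingCoeff_shiftedGegenbauer_pos hα hl (n + 1)).ne'
  have hd1 : (shiftedGegenbauer α l (n + 1)).degree = ((n + 1 : ℕ) : WithBot ℕ) := by
    rw [Polynomial.degree_eq_natDegree (shiftedGegenbauer_ne_zero hα hl _),
      natDegree_shiftedGegenbauer hα hl]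
  refine Polynomial.eq_of_degree_le_of_eval_index_eq (v := node α l n) Finset.univ
    (strictMono_node hα hl n).injective.injOn ?_ ?_ ?_ ?_
  · rw [hd1]; simp
  · rw [hd1, Polynomial.degree_C_mul hK, Lagrange.degree_nodal]; simp
  · rw [Polynomial.leadingCoeff_mul, Polynomial.leadingCoeff_C,
      (Lagrange.nodal_monic (s := Finset.univ) (v := node α l n)).leadingCoeff, mul_one]
  · intro i hi
    rw [eval_node hα hl, Polynomial.eval_mul, Lagrange.eval_nodal_at_node hi, mul_zero]

end

/-! ### Christoffel numbers and barycentric weights -/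

section
variable {α l : ℝ}

theorem basis_eq_nodalWeight_mul_nodal {n : ℕ} (v : Fin n → ℝ) (j : Fin n) :
    Lagrange.basis Finset.univ v j = Polynomial.C (Lagrange.nodalWeight Finset.univ v j) *
      Lagrange.nodal (Finset.univ.erase j) v := by
  rw [Lagrange.basis_eq_prod_sub_inv_mul_nodal_div (Finset.mem_univ j),
    Lagrange.nodal_erase_eq_nodal_div (Finset.mem_univ j)]

theorem christoffel_eq (n : ℕ) (j : Fin (n + 1)) :
    christoffel α l n j = Lagrange.nodalWeight Finset.univ (node α l n) j *
      wInt α l (Lagrange.nodal (Finset.univ.erase j) (node α l n)) := by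
  rw [← wInt_C_mul, ← basis_eq_nodalWeight_mul_nodal]
  rfl

/-- Compute the integral of `r S` in two ways. Replacing `r` by its leading multiple of `S` costs a
polynomial of lower degree, orthogonal to `S`. Replacing `S` by its value at the node costs the
nodal polynomial times a factor `t` of degree at most `n`, which integrates to zero. The point is
that the right side does not depend on `j`. -/
theorem wInt_nodal_erase_mul (hα : -(1 / 2) < α) (hl : 0 < l) (n : ℕ) (j : Fin (n + 1)) :
    wInt α l (Lagrange.nodal (Finset.univ.erase j) (node α l n)) *
        (shiftedGegenbauer α l n).eval (node α l n j) =
      ((shiftedGegenbauer α l n).leadingCoeff)⁻¹ *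
        wInt α l (shiftedGegenbauer α l n * shiftedGegenbauer α l n) := by
  set r := Lagrange.nodal (Finset.univ.erase j) (node α l n) with hr
  set S := shiftedGegenbauer α l n with hS
  have hlc := leadingCoeff_shiftedGegenbauer_pos hα hl n
  rw [← hS] at hlc
  have hrdeg : r.natDegree = n := by
    rw [hr, Lagrange.natDegree_nodal, Finset.card_erase_of_mem (Finset.mem_univ j)]
    simp
  have hrm : r.Monic := Lagrange.nodal_monic
  have hSdeg : S.natDegree = n := natDegree_shiftedGegenbauer hα hl n
  have hdiff : (r - Polynomial.C S.leadingCoeff⁻¹ * S).degree < n := by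
    rw [Polynomial.degree_lt_iff_coeff_zero]
    intro k hk
    rw [Polynomial.coeff_sub, Polynomial.coeff_C_mul]
    rcases hk.eq_or_lt with rfl | hk
    · have h1 : r.coeff n = 1 := by
        have := hrm.coeff_natDegree
        rwa [hrdeg] at this
      have h2 : S.coeff n = S.leadingCoeff := by rw [Polynomial.leadingCoeff, hSdeg]
      rw [h1, h2, inv_mul_cancel₀ hlc.ne', sub_self]
    · rw [Polynomial.coeff_eq_zero_of_natDegree_lt (by rwa [hrdeg]),
        Polynomial.coeff_eq_zero_of_natDegree_lt (by rwa [hSdeg])]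
      simp
  have h1 : wInt α l (r * S) = S.leadingCoeff⁻¹ * wInt α l (S * S) := by
    have h : r * S = S * (r - Polynomial.C S.leadingCoeff⁻¹ * S) +
        Polynomial.C S.leadingCoeff⁻¹ * (S * S) := by ring
    rw [h, wInt_add hα hl, wInt_C_mul, hS, wInt_shiftedGegenbauer_mul hα hl hdiff, zero_add]
  rw [← h1]
  set x := node α l n j
  obtain ⟨t, ht⟩ := Polynomial.X_sub_C_dvd_sub_C_eval (a := x) (p := S)
  have htdeg : t.degree < ((n + 1 : ℕ) : WithBot ℕ) := by
    rcases eq_or_ne t 0 with rfl | ht0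
    · simp
    have h2 := congrArg Polynomial.natDegree ht
    rw [Polynomial.natDegree_sub_C, hSdeg,
      Polynomial.natDegree_mul (Polynomial.X_sub_C_ne_zero x) ht0,
      Polynomial.natDegree_X_sub_C] at h2
    rw [← Polynomial.natDegree_lt_iff_degree_lt ht0]
    omega
  have h3 : r * S = Polynomial.C (S.eval x) * r +
      Lagrange.nodal Finset.univ (node α l n) * t := by
    rw [Lagrange.nodal_eq_mul_nodal_erase (Finset.mem_univ j)]
    linear_combination r * ht
  have h4 : wInt α l (Lagrange.nodal Finset.univ (node α l n) * t) = 0 := by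
    have h5 := wInt_shiftedGegenbauer_mul hα hl htdeg
    rw [shiftedGegenbauer_eq_nodal hα hl, mul_assoc, wInt_C_mul] at h5
    exact (mul_eq_zero.1 h5).resolve_left (leadingCoeff_shiftedGegenbauer_pos hα hl (n + 1)).ne'
  rw [h3, wInt_add hα hl, wInt_C_mul, h4]
  ring

theorem derivative_eval_node (hα : -(1 / 2) < α) (hl : 0 < l) (n : ℕ) (j : Fin (n + 1)) :
    (Polynomial.derivative (shiftedGegenbauer α l (n + 1))).eval (node α l n j) =
      (shiftedGegenbauer α l (n + 1)).leadingCoeff /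
        Lagrange.nodalWeight Finset.univ (node α l n) j := by
  rw [Lagrange.nodalWeight_eq_eval_derivative_nodal (Finset.mem_univ j), div_inv_eq_mul]
  conv_lhs => rw [shiftedGegenbauer_eq_nodal hα hl]
  simp

theorem structure_at_node (hα : -(1 / 2) < α) (hl : 0 < l) (n : ℕ) (j : Fin (n + 1)) :
    2 / l * (node α l n j * (l - node α l n j)) *
        (Polynomial.derivative (shiftedGegenbauer α l (n + 1))).eval (node α l n j) =
      ((n : ℝ) + 1) * (shiftedGegenbauer α l n).eval (node α l n j) := by
  set x := node α l n j with hx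
  have h0 := eval_node hα hl n j
  rw [← hx, eval_shiftedGegenbauer] at h0
  have h := congrArg (Polynomial.eval (2 / l * x - 1)) (gegenbauer_structure hα n).1
  simp only [Polynomial.eval_mul, Polynomial.eval_sub, Polynomial.eval_pow, Polynomial.eval_X,
    Polynomial.eval_one, Polynomial.eval_add, Polynomial.eval_natCast, h0, one_sub_shift_sq hl,
    mul_zero, sub_zero] at h
  rw [eval_shiftedGegenbauer, ← h, derivative_shiftedGegenbauer]
  simp only [Polynomial.eval_mul, Polynomial.eval_C, Polynomial.eval_comp, Polynomial.eval_sub,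
    Polynomial.eval_X, Polynomial.eval_one]
  field_simp
  ring

/-- The Christoffel numbers in terms of the nodal weights. -/
theorem exists_christoffel_mul_eq (hα : -(1 / 2) < α) (hl : 0 < l) (n : ℕ) :
    ∃ c : ℝ, 0 < c ∧ ∀ j, (l - node α l n j) * node α l n j * christoffel α l n j =
      c * Lagrange.nodalWeight Finset.univ (node α l n) j ^ 2 := by
  have hK := leadingCoeff_shiftedGegenbauer_pos hα hl (n + 1)
  have hk := leadingCoeff_shiftedGegenbauer_pos hα hl n
  have hS := shiftedGegenbauer_ne_zero hα hl n
  have hH : 0 < wInt α l (shiftedGegenbauer α l n * shiftedGegenbauer α l n) :=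
    wInt_pos hl hα (mul_ne_zero hS hS) fun x _ => by
      rw [Polynomial.eval_mul]
      exact mul_self_nonneg _
  refine ⟨((shiftedGegenbauer α l n).leadingCoeff)⁻¹ *
    wInt α l (shiftedGegenbauer α l n * shiftedGegenbauer α l n) * ((n : ℝ) + 1) * l /
      (2 * (shiftedGegenbauer α l (n + 1)).leadingCoeff), by positivity, fun j => ?_⟩
  have h1 := wInt_nodal_erase_mul hα hl n j
  have h2 := structure_at_node hα hl n j
  rw [derivative_eval_node hα hl] at h2
  rw [← h1, christoffel_eq]
  have hw := Lagrange.nodalWeight_ne_zero (s := Finset.univ) (v := node α l n)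
    (strictMono_node hα hl n).injective.injOn (Finset.mem_univ j)
  set w := Lagrange.nodalWeight Finset.univ (node α l n) j
  set I := wInt α l (Lagrange.nodal (Finset.univ.erase j) (node α l n))
  set K := (shiftedGegenbauer α l (n + 1)).leadingCoeff
  set s := (shiftedGegenbauer α l n).eval (node α l n j)
  set x := node α l n j
  have hn : (n : ℝ) + 1 ≠ 0 := by positivity
  -- This brings in the factor `x (l - x)` and a second nodal weight, making the left side
  -- proportional to `w ^ 2`.
  have hs : s = 2 / l * (x * (l - x)) * (K / w) / ((n : ℝ) + 1) := by
    rw [h2]; field_simp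
  rw [hs]
  have := hK.ne'
  field_simp

/-- Each of the `n - j` nodes above `v j` contributes one negative factor, so the weight has sign
`(-1) ^ (n - j)`. -/
theorem neg_one_pow_mul_nodalWeight_pos {n : ℕ} {v : Fin (n + 1) → ℝ} (hv : StrictMono v)
    (j : Fin (n + 1)) : 0 < (-1) ^ n * ((-1) ^ (j : ℕ) * Lagrange.nodalWeight Finset.univ v j) := by
  have h1 : ∀ k ∈ Finset.univ.erase j, (v j - v k)⁻¹ =
      (if j < k then (-1 : ℝ) else 1) * |v j - v k|⁻¹ := by
    intro k hk
    split_ifs with hjk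
    · have := hv hjk
      rw [abs_of_neg (by linarith), inv_neg]
      ring
    · have : k < j := lt_of_le_of_ne (not_lt.1 hjk) (Finset.ne_of_mem_erase hk)
      have := hv this
      rw [abs_of_pos (by linarith), one_mul]
  have h2 : (Finset.univ.erase j).filter (fun k => j < k) = Finset.Ioi j := by
    ext k
    simp only [Finset.mem_filter, Finset.mem_erase, Finset.mem_univ, and_true, Finset.mem_Ioi]
    exact ⟨fun h => h.2, fun h => ⟨h.ne', h⟩⟩
  rw [Lagrange.nodalWeight, Finset.prod_congr rfl h1, Finset.prod_mul_distrib, Finset.prod_ite,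
    h2, Finset.prod_const, Finset.prod_const_one, Fin.card_Ioi, mul_one, ← mul_assoc, ← mul_assoc,
    ← pow_add, ← pow_add]
  have h3 : Even (n + (j : ℕ) + (n + 1 - 1 - (j : ℕ))) := by
    have := j.2
    exact ⟨n, by omega⟩
  rw [h3.neg_one_pow, one_mul]
  refine Finset.prod_pos fun k hk => inv_pos.2 (abs_pos.2 (sub_ne_zero.2 ?_))
  exact fun h => Finset.ne_of_mem_erase hk (hv.injective h).symm

/-- The square root recovers the modulus of the nodal weight up to a constant, and the prescribed
alternation recovers its sign up to the global factor `(-1) ^ n`. -/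
theorem exists_baryWeight_eq (hα : -(1 / 2) < α) (hl : 0 < l) (n : ℕ) :
    ∃ c : ℝ, c ≠ 0 ∧ ∀ j, baryWeight α l n j =
      c * Lagrange.nodalWeight Finset.univ (node α l n) j := by
  obtain ⟨c, hc, h⟩ := exists_christoffel_mul_eq hα hl n
  set d := (4 : ℝ) ^ α * l ^ (-2 * (1 + α)) * c with hd
  have hd0 : 0 < d := by positivity
  refine ⟨2 * Real.sqrt d * (-1) ^ n, by positivity, fun j => ?_⟩
  have hpos := neg_one_pow_mul_nodalWeight_pos (strictMono_node hα hl n) j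
  set w := Lagrange.nodalWeight Finset.univ (node α l n) j with hw
  have hrw : (4 : ℝ) ^ α * l ^ (-2 * (1 + α)) * (l - node α l n j) * node α l n j *
      christoffel α l n j = d * ((-1) ^ n * ((-1) ^ (j : ℕ) * w)) ^ 2 := by
    have hsq : ∀ k : ℕ, ((-1 : ℝ) ^ k) ^ 2 = 1 := fun k => by
      rw [← pow_mul, mul_comm, pow_mul]; simp
    rw [mul_pow, mul_pow, hsq, hsq]
    linear_combination ((4 : ℝ) ^ α * l ^ (-2 * (1 + α))) * h j
  have hj : ((-1 : ℝ) ^ (j : ℕ)) * (-1) ^ (j : ℕ) = 1 := by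
    rw [← mul_pow]; simp
  rw [baryWeight, hrw, Real.sqrt_mul hd0.le, Real.sqrt_sq hpos.le]
  linear_combination 2 * Real.sqrt d * (-1) ^ n * w * hj

/-- A factor common to all weights cancels in the barycentric quotient. -/
theorem baryLagrange_eq_eval_basis (hα : -(1 / 2) < α) (hl : 0 < l) (n : ℕ) (j : Fin (n + 1))
    (x : ℝ) :
    baryLagrange α l n j x = (Lagrange.basis Finset.univ (node α l n) j).eval x := by
  have hinj := (strictMono_node hα hl n).injective
  rw [baryLagrange]
  split_ifs with h1 h2
  · rw [h1, Lagrange.eval_basis_self hinj.injOn (Finset.mem_univ j)]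
  · obtain ⟨k, rfl⟩ := h2
    rw [Lagrange.eval_basis_of_ne (fun h => h1 (by rw [h])) (Finset.mem_univ k)]
  · push Not at h2
    obtain ⟨c, hc, hb⟩ := exists_baryWeight_eq hα hl n
    have hne := Lagrange.sum_nodalWeight_mul_inv_sub_ne_zero (s := Finset.univ)
      hinj.injOn (fun i _ => h2 i) Finset.univ_nonempty
    -- Interpolating the constant `1` shows that the barycentric denominator with nodal weights is
    -- the reciprocal of the nodal polynomial.
    have hone := Lagrange.eval_interpolate_not_at_node (s := Finset.univ) (v := node α l n)
      (r := 1) (x := x) fun i _ => h2 i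
    rw [Lagrange.interpolate_one hinj.injOn Finset.univ_nonempty, Polynomial.eval_one] at hone
    simp only [Pi.one_apply, mul_one] at hone
    rw [Lagrange.eval_basis_not_at_node (Finset.mem_univ j) h1]
    simp only [hb, mul_div_assoc, ← Finset.mul_sum]
    simp only [← div_eq_mul_inv] at hone hne ⊢
    rw [← mul_div_assoc, mul_div_mul_left _ _ hc, div_eq_iff hne, mul_right_comm, ← hone, one_mul]

/-! ### The truncation error -/

/-- The Cauchy kernel is based at the same node `x_i` as the matrix row, so the row's factor `(x_i -
x_j) ^ q` is the kernel's value at `x_j`, and the quadrature integrates the interpolant of kernel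
times `f`. -/
theorem truncError_eq_integral (hα : -(1 / 2) < α) (hl : 0 < l) (n q : ℕ) {f : ℝ → ℝ}
    (hf : ContinuousOn f (Set.Icc 0 l)) (i : Fin (n + 1)) :
    truncError α l n (q + 1) f i = (∫ y in (0 : ℝ)..node α l n i,
      ((node α l n i - y) ^ q * f y - (Lagrange.interpolate Finset.univ (node α l n)
        (fun j => (node α l n i - node α l n j) ^ q * f (node α l n j))).eval y)) /
          (Nat.factorial q : ℝ) := by
  have hx := node_mem_Ioo hα hl n i
  set x := node α l n i with hxdef
  have hsub : Set.uIcc 0 x ⊆ Set.Icc 0 l := by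
    rw [Set.uIcc_of_le hx.1.le]
    exact Set.Icc_subset_Icc_right hx.2.le
  have hint : IntervalIntegrable (fun y => (x - y) ^ q * f y) MeasureTheory.volume 0 x :=
    ContinuousOn.intervalIntegrable
      ((Continuous.continuousOn (by fun_prop)).mul (hf.mono hsub))
  rw [intervalIntegral.integral_sub hint ((Polynomial.continuous _).intervalIntegrable _ _),
    sub_div, truncError, iterIntegral_succ_eq hf q (Set.Ioo_subset_Icc_self hx)]
  congr 1
  · rw [← intervalIntegral.integral_div]
    congr 1
    funext y
    ring
  · simp only [Matrix.mulVec, dotProduct, intMatrix, Matrix.of_apply, Nat.add_sub_cancel,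
      baryLagrange_eq_eval_basis hα hl, Lagrange.interpolate_apply, Polynomial.eval_finsetSum,
      Polynomial.eval_mul, Polynomial.eval_C]
    rw [intervalIntegral.integral_finsetSum (fun j _ => Continuous.intervalIntegrable
      (by fun_prop) _ _), Finset.sum_div]
    refine Finset.sum_congr rfl fun j _ => ?_
    rw [intervalIntegral.integral_const_mul]
    ring

theorem abs_truncError_lt (hα : -(1 / 2) < α) (hl : 0 < l) (n q : ℕ) {f : ℝ → ℝ}
    (hf : ContDiffOn ℝ ((n + 1 : ℕ) : WithTop ℕ∞) f (Set.Icc 0 l)) (i : Fin (n + 1)) {A : ℝ}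
    (hA0 : 0 < A)
    (hA : ∀ x ∈ Set.Ioo 0 l, |iteratedDerivWithin (n + 1)
      (fun y => (node α l n i - y) ^ q * f y) (Set.Icc 0 l) x| ≤ A)
    {M : ℝ} (hM0 : 0 < M) (hM : ∀ t ∈ Set.Icc (-1 : ℝ) 1, |(gegenbauer α (n + 1)).eval t| ≤ M) :
    |truncError α l n (q + 1) f i| < A * node α l n i * M /
      ((Nat.factorial q : ℝ) * (Nat.factorial (n + 1) : ℝ) *
        (gegenbauerLead α n * (2 / l) ^ (n + 1))) := by
  have hx := node_mem_Ioo hα hl n i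
  have hinj := (strictMono_node hα hl n).injective
  have hK := leadingCoeff_shiftedGegenbauer_pos hα hl (n + 1)
  rw [leadingCoeff_shiftedGegenbauer hα hl] at hK
  have hfac : (0 : ℝ) < Nat.factorial (n + 1) := by positivity
  set K := gegenbauerLead α n * (2 / l) ^ (n + 1) with hKdef
  have hnodal : ∀ y ∈ Set.Icc 0 l,
      |(Lagrange.nodal Finset.univ (node α l n)).eval y| ≤ M / K := by
    intro y hy
    have h1 := congrArg (Polynomial.eval y) (shiftedGegenbauer_eq_nodal hα hl n)
    rw [Polynomial.eval_mul, Polynomial.eval_C, leadingCoeff_shiftedGegenbauer hα hl,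
      eval_shiftedGegenbauer, ← hKdef] at h1
    have h2 := hM (2 / l * y - 1) (by
      have h3 : 2 / l * y = 2 * (y / l) := by ring
      have h4 : 0 ≤ y / l := div_nonneg hy.1 hl.le
      have h5 : y / l ≤ 1 := (div_le_one hl).2 hy.2
      rw [h3]
      constructor <;> linarith)
    rw [h1, abs_mul, abs_of_pos hK] at h2
    rw [le_div_iff₀ hK]
    linarith
  have hg : ContDiffOn ℝ ((n + 1 : ℕ) : WithTop ℕ∞)
      (fun y => (node α l n i - y) ^ q * f y) (Set.Icc 0 l) :=
    (ContDiff.contDiffOn (by fun_prop)).mul hf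
  rw [truncError_eq_integral hα hl n q hf.continuousOn i, abs_div,
    abs_of_pos (show (0 : ℝ) < Nat.factorial q by positivity)]
  have hbound : ∀ y ∈ Set.Icc 0 l, |(node α l n i - y) ^ q * f y -
      (Lagrange.interpolate Finset.univ (node α l n)
        (fun j => (node α l n i - node α l n j) ^ q * f (node α l n j))).eval y| ≤
      A / (Nat.factorial (n + 1) : ℝ) * |(Lagrange.nodal Finset.univ (node α l n)).eval y| :=
    fun y hy => abs_sub_interpolate_le hg hinj
      (fun j => Set.Ioo_subset_Icc_self (node_mem_Ioo hα hl n j)) hA hy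
  set x := node α l n i with hxdef
  have hIcc : Set.Icc 0 x ⊆ Set.Icc 0 l := Set.Icc_subset_Icc_right hx.2.le
  have hlt : |∫ y in (0 : ℝ)..x, ((x - y) ^ q * f y -
      (Lagrange.interpolate Finset.univ (node α l n)
        (fun j => (x - node α l n j) ^ q * f (node α l n j))).eval y)| <
      A / (Nat.factorial (n + 1) : ℝ) * (M / K) * x := by
    have h1 : |∫ y in (0 : ℝ)..x, ((x - y) ^ q * f y -
      (Lagrange.interpolate Finset.univ (node α l n)
        (fun j => (x - node α l n j) ^ q * f (node α l n j))).eval y)| ≤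
        ∫ y in (0 : ℝ)..x, A / (Nat.factorial (n + 1) : ℝ) *
          |(Lagrange.nodal Finset.univ (node α l n)).eval y| := by
      rw [← Real.norm_eq_abs]
      refine intervalIntegral.norm_integral_le_of_norm_le hx.1.le ?_ ?_
      · refine Filter.Eventually.of_forall fun y hy => ?_
        exact hbound y (hIcc (Set.Ioc_subset_Icc_self hy))
      · exact Continuous.intervalIntegrable
          (continuous_const.mul (Polynomial.continuous _).abs) _ _
    refine h1.trans_lt ?_
    have h2 := intervalIntegral.integral_lt_integral_of_continuousOn_of_le_of_exists_lt
      (f := fun y => A / (Nat.factorial (n + 1) : ℝ) *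
          |(Lagrange.nodal Finset.univ (node α l n)).eval y|)
      (g := fun _ => A / (Nat.factorial (n + 1) : ℝ) * (M / K)) hx.1
      (continuous_const.mul (Polynomial.continuous _).abs).continuousOn continuousOn_const
      (fun y hy => by
        have := hnodal y (hIcc (Set.Ioc_subset_Icc_self hy))
        gcongr)
      -- Strictness comes from the upper endpoint: it is a node, so the nodal polynomial vanishes
      -- there.
      ⟨x, ⟨hx.1.le, le_rfl⟩, by
        rw [hxdef, Lagrange.eval_nodal_at_node (Finset.mem_univ i), abs_zero, mul_zero]
        positivity⟩
    refine h2.trans_eq ?_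
    simp
    ring
  rw [div_lt_iff₀ (by positivity)]
  refine hlt.trans_eq ?_
  field_simp

end

/-! ### Closed forms -/

section
variable {α l : ℝ}

/-- The absolute value at the origin of the Gegenbauer polynomial of degree `2 k`. -/
def evenCenter (α : ℝ) (k : ℕ) : ℝ :=
  ∏ j ∈ Finset.range k, (2 * (j : ℝ) + 1) / (2 * (j : ℝ) + 1 + 2 * α)

theorem evenCenter_pos (hα : -(1 / 2) < α) (k : ℕ) : 0 < evenCenter α k := by
  refine Finset.prod_pos fun j _ => ?_
  have : (0 : ℝ) ≤ j := Nat.cast_nonneg j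
  exact div_pos (by linarith) (by linarith)

theorem choose_add_sub_one (r : ℝ) (k : ℕ) :
    Ring.choose ((k : ℝ) + r - 1) k = (∏ j ∈ Finset.range k, (r + j)) / (Nat.factorial k : ℝ) := by
  have h := Ring.factorial_nsmul_multichoose_eq_ascPochhammer r k
  rw [Polynomial.ascPochhammer_smeval_eq_eval, Ring.multichoose_eq, nsmul_eq_mul,
    add_comm r] at h
  have h0 : (Nat.factorial k : ℝ) ≠ 0 := by positivity
  rw [eq_div_iff h0, mul_comm, h]
  clear h
  induction k with
  | zero => simp
  | succ k ih =>
    rw [ascPochhammer_succ_eval, Finset.prod_range_succ, ih (by positivity)]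

theorem evenCenter_eq (hα : -(1 / 2) < α) (k : ℕ) :
    evenCenter α k = Ring.choose ((k : ℝ) + α) k *
      ((Nat.factorial (2 * k) : ℝ) * Real.Gamma (2 * α + 1) / Real.Gamma (2 * k + 2 * α + 1)) := by
  have h := choose_add_sub_one (α + 1) k
  rw [show (k : ℝ) + (α + 1) - 1 = k + α by ring] at h
  rw [h]
  clear h
  induction k with
  | zero =>
    have := Real.Gamma_pos_of_pos (show 0 < 2 * α + 1 by linarith)
    simp [evenCenter, this.ne']
  | succ k ih =>
    have hk : (0 : ℝ) ≤ k := Nat.cast_nonneg k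
    have h0 := Real.Gamma_pos_of_pos (show 0 < 2 * k + 2 * α + 1 by linarith)
    have h1 : 2 * (k : ℝ) + 2 * α + 1 ≠ 0 := by linarith
    rw [evenCenter, Finset.prod_range_succ, ← evenCenter, ih, Finset.prod_range_succ,
      show 2 * (k + 1) = 2 * k + 1 + 1 by ring, Nat.factorial_succ, Nat.factorial_succ,
      Nat.factorial_succ]
    push_cast
    rw [show 2 * ((k : ℝ) + 1) + 2 * α + 1 = (2 * k + 2 * α + 1) + 1 + 1 by ring,
      Real.Gamma_add_one (show 2 * (k : ℝ) + 2 * α + 1 + 1 ≠ 0 by linarith),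
      Real.Gamma_add_one h1]
    set g := Real.Gamma (2 * k + 2 * α + 1)
    rw [show 2 * (k : ℝ) + 1 + 2 * α = 2 * k + 2 * α + 1 by ring,
      show 2 * (k : ℝ) + 2 * α + 1 + 1 = 2 * (k + α + 1) by ring]
    set b := 2 * (k : ℝ) + 2 * α + 1
    have h5 : (k : ℝ) + α + 1 ≠ 0 := by linarith
    field_simp
    ring

/-- At `k = 0` both `Γ(2 α)` and `α + k` are negative, as `2 α` lies in `(-1, 0)`; absolute values
keep the induction uniform. -/
theorem evenCenter_eq_of_neg (hα : -(1 / 2) < α) (hα0 : α < 0) (k : ℕ) :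
    evenCenter α k = (Nat.factorial (2 * k) : ℝ) * |Real.Gamma (2 * α)| /
      |Real.Gamma (2 * k + 2 * α)| * |Ring.choose ((k : ℝ) + α - 1) k| := by
  have hne : ∀ m : ℕ, (m : ℝ) + 2 * α ≠ 0 := by
    intro m
    rcases Nat.eq_zero_or_pos m with rfl | hm
    · simp; exact hα0.ne
    · have : (1 : ℝ) ≤ m := by exact_mod_cast hm
      linarith
  have hΓ : ∀ m : ℕ, Real.Gamma (m + 2 * α) ≠ 0 := by
    intro m
    refine Real.Gamma_ne_zero fun j hj => ?_
    have h := hne (m + j)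
    push_cast at h
    exact h (by linarith)
  rw [choose_add_sub_one]
  induction k with
  | zero =>
    have h := hΓ 0
    simp only [Nat.cast_zero, zero_add] at h
    simp [evenCenter, h]
  | succ k ih =>
    have hk : (0 : ℝ) ≤ k := Nat.cast_nonneg k
    have h0 := hΓ (2 * k)
    have h1 := hne (2 * k)
    have h2 := hne (2 * k + 1)
    push_cast at h0 h1 h2
    have h3 : 0 < 2 * (k : ℝ) + 1 + 2 * α := by linarith
    rw [evenCenter, Finset.prod_range_succ, ← evenCenter, ih, Finset.prod_range_succ,
      show 2 * (k + 1) = 2 * k + 1 + 1 by ring, Nat.factorial_succ, Nat.factorial_succ,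
      Nat.factorial_succ]
    push_cast
    rw [show 2 * ((k : ℝ) + 1) + 2 * α = (2 * k + 2 * α) + 1 + 1 by ring,
      Real.Gamma_add_one (show 2 * (k : ℝ) + 2 * α + 1 ≠ 0 by linarith),
      Real.Gamma_add_one h1, abs_div, abs_div, abs_mul, abs_mul, abs_mul,
      show 2 * (k : ℝ) + 2 * α = 2 * (α + k) by ring, abs_mul,
      show 2 * (α + (k : ℝ)) + 1 = 2 * k + 1 + 2 * α by ring, abs_of_pos h3, abs_two,
      abs_mul, Nat.abs_cast, abs_of_pos (show 0 < (k : ℝ) + 1 by positivity)]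
    rw [show 2 * (k : ℝ) + 2 * α = 2 * (α + k) by ring] at h0 h1
    have h5 : |α + (k : ℝ)| ≠ 0 := abs_ne_zero.2 (right_ne_zero_of_mul h1)
    have h6 := abs_ne_zero.2 h0
    set g := |Real.Gamma (2 * (α + k))|
    set a := |α + (k : ℝ)|
    field_simp
    ring

/-- Both arguments are put in the form `k + 1 + s` with `s > -1`, as the asymptotics of Gamma below
require. -/
theorem evenCenter_eq_Gamma (hα : -(1 / 2) < α) (k : ℕ) :
    evenCenter α k = Real.Gamma (k + 1 + -(1 / 2)) / Real.Gamma (k + 1 + (α - 1 / 2)) *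
      (Real.Gamma (α + 1 / 2) / Real.Gamma (1 / 2)) := by
  rw [show (k : ℝ) + 1 + -(1 / 2) = k + 1 / 2 by ring,
    show (k : ℝ) + 1 + (α - 1 / 2) = k + (α + 1 / 2) by ring]
  have hG2 := Real.Gamma_pos_of_pos (show (0 : ℝ) < 1 / 2 by norm_num)
  induction k with
  | zero =>
    have hG1 := Real.Gamma_pos_of_pos (show 0 < α + 1 / 2 by linarith)
    rw [Nat.cast_zero, zero_add, zero_add]
    simp only [evenCenter, Finset.range_zero, Finset.prod_empty]
    rw [div_mul_div_comm, mul_comm, div_self (by positivity)]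
  | succ k ih =>
    have hk : (0 : ℝ) ≤ k := Nat.cast_nonneg k
    have h1 : (k : ℝ) + (α + 1 / 2) ≠ 0 := by linarith
    have h2 : 2 * (k : ℝ) + 1 + 2 * α ≠ 0 := by linarith
    rw [evenCenter, Finset.prod_range_succ, ← evenCenter, ih]
    push_cast
    rw [show (k : ℝ) + 1 + 1 / 2 = (k + 1 / 2) + 1 by ring,
      show (k : ℝ) + 1 + (α + 1 / 2) = (k + (α + 1 / 2)) + 1 by ring,
      Real.Gamma_add_one (show (k : ℝ) + 1 / 2 ≠ 0 by positivity), Real.Gamma_add_one h1,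
      show (2 * (k : ℝ) + 1) / (2 * k + 1 + 2 * α) = (k + 1 / 2) / (k + (α + 1 / 2)) by
        rw [div_eq_div_iff h2 h1]; ring]
    set a := Real.Gamma ((k : ℝ) + 1 / 2)
    set b := Real.Gamma ((k : ℝ) + (α + 1 / 2))
    rw [div_mul_eq_mul_div, div_mul_div_comm, div_mul_eq_mul_div]
    congr 1
    · ring
    · ring

/-! ### Asymptotic bounds -/

open Filter Topology in
-- This is Euler's limit `Real.GammaSeq_tendsto_Gamma`: the product in its denominator is `Γ(n + 1 +
-- s) / Γ(s)`.
theorem tendsto_Gamma_div_of_pos {s : ℝ} (hs : 0 < s) :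
    Tendsto (fun n : ℕ => Real.Gamma (n + 1 + s) / ((Nat.factorial n : ℝ) * (n : ℝ) ^ s))
      atTop (𝓝 1) := by
  have hΓ := Real.Gamma_pos_of_pos hs
  have h := (tendsto_const_nhds (x := Real.Gamma s)).div (Real.GammaSeq_tendsto_Gamma s) hΓ.ne'
  rw [div_self hΓ.ne'] at h
  refine h.congr fun n => ?_
  have hprod : ∀ m : ℕ, Real.Gamma s * ∏ j ∈ Finset.range m, (s + (j : ℝ)) = Real.Gamma (s + m) := by
    intro m
    induction m with
    | zero => simp
    | succ m ih =>
      have : s + (m : ℝ) ≠ 0 := by positivity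
      rw [Finset.prod_range_succ, ← mul_assoc, ih]
      push_cast
      rw [← add_assoc, Real.Gamma_add_one this, mul_comm]
  simp only [Pi.div_apply]
  rw [Real.GammaSeq, div_div_eq_mul_div, hprod]
  push_cast
  rw [show s + ((n : ℝ) + 1) = n + 1 + s by ring, mul_comm (Nat.factorial n : ℝ)]

open Filter Topology in
-- Dividing one factor `n + 1 + s` out of the case `s + 1` extends the range to negative `s`, needed
-- for the exponents `α`, `2 α` and `α - 1/2`.
theorem tendsto_Gamma_div {s : ℝ} (hs : -1 < s) :
    Tendsto (fun n : ℕ => Real.Gamma (n + 1 + s) / ((Nat.factorial n : ℝ) * (n : ℝ) ^ s))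
      atTop (𝓝 1) := by
  have h1 := tendsto_Gamma_div_of_pos (show 0 < s + 1 by linarith)
  have h2 : Tendsto (fun n : ℕ => (n : ℝ) / (n + (1 + s))) atTop (𝓝 1) :=
    tendsto_natCast_div_add_atTop (1 + s)
  have h := h1.mul h2
  rw [mul_one] at h
  refine h.congr' ?_
  filter_upwards [eventually_ge_atTop 1] with n hn
  have hn' : (1 : ℝ) ≤ n := by exact_mod_cast hn
  have h3 : (n : ℝ) + 1 + s ≠ 0 := by linarith
  have h4 : (0 : ℝ) < n := by linarith
  rw [← add_assoc, Real.Gamma_add_one h3, Real.rpow_add_one h4.ne', ← add_assoc]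
  have : (0 : ℝ) < (n : ℝ) ^ s := Real.rpow_pos_of_pos h4 s
  field_simp

open Filter in
theorem eventually_Gamma_bounds {s : ℝ} (hs : -1 < s) :
    ∀ᶠ n : ℕ in atTop,
      (Nat.factorial n : ℝ) * (n : ℝ) ^ s / 2 ≤ Real.Gamma (n + 1 + s) ∧
      Real.Gamma (n + 1 + s) ≤ 2 * ((Nat.factorial n : ℝ) * (n : ℝ) ^ s) := by
  have h := tendsto_Gamma_div hs
  filter_upwards [h.eventually (lt_mem_nhds (show (1 / 2 : ℝ) < 1 by norm_num)),
    h.eventually (gt_mem_nhds (show (1 : ℝ) < 2 by norm_num)), eventually_ge_atTop 1]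
    with n h1 h2 hn
  have h4 : (0 : ℝ) < n := by exact_mod_cast hn
  have : (0 : ℝ) < (n : ℝ) ^ s := Real.rpow_pos_of_pos h4 s
  rw [lt_div_iff₀ (by positivity)] at h1
  rw [div_lt_iff₀ (by positivity)] at h2
  constructor <;> linarith

open Filter in
theorem eventually_evenCenter_le (hα : -(1 / 2) < α) :
    ∃ C : ℝ, 0 < C ∧ ∀ᶠ k : ℕ in atTop, evenCenter α k ≤ C * (k : ℝ) ^ (-α) := by
  have hG1 := Real.Gamma_pos_of_pos (show 0 < α + 1 / 2 by linarith)
  have hG2 := Real.Gamma_pos_of_pos (show (0 : ℝ) < 1 / 2 by norm_num)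
  refine ⟨4 * (Real.Gamma (α + 1 / 2) / Real.Gamma (1 / 2)), by positivity, ?_⟩
  filter_upwards [eventually_Gamma_bounds (show -1 < -(1 / 2 : ℝ) by norm_num),
    eventually_Gamma_bounds (show -1 < α - 1 / 2 by linarith), eventually_ge_atTop 1]
    with k h1 h2 hk
  have h4 : (0 : ℝ) < k := by exact_mod_cast hk
  rw [evenCenter_eq_Gamma hα, mul_right_comm]
  refine mul_le_mul_of_nonneg_right ?_ (by positivity)
  have hp : (0 : ℝ) < (k : ℝ) ^ (α - 1 / 2) := Real.rpow_pos_of_pos h4 _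
  have hsplit : (k : ℝ) ^ (-(1 / 2) : ℝ) = (k : ℝ) ^ (-α) * (k : ℝ) ^ (α - 1 / 2) := by
    rw [← Real.rpow_add h4]
    congr 1
    ring
  have hlow : 0 < (Nat.factorial k : ℝ) * (k : ℝ) ^ (α - 1 / 2) / 2 := by positivity
  rw [div_le_iff₀ (hlow.trans_le h2.1)]
  have hq : (0 : ℝ) < (k : ℝ) ^ (-α) := Real.rpow_pos_of_pos h4 _
  calc _ ≤ _ := h1.2
    _ = 4 * (k : ℝ) ^ (-α) * ((Nat.factorial k : ℝ) * (k : ℝ) ^ (α - 1 / 2) / 2) := by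
      rw [hsplit]; ring
    _ ≤ _ := by gcongr; exact h2.1

/-- Stirling's lower bound, with the factor `√(2π) ≥ 1` discarded. -/
theorem inv_factorial_le {n : ℕ} (hn : 1 ≤ n) :
    ((Nat.factorial n : ℝ))⁻¹ ≤ Real.exp n / (n : ℝ) ^ ((n : ℝ) + 1 / 2) := by
  have h4 : (0 : ℝ) < n := by exact_mod_cast hn
  have h := Stirling.le_factorial_stirling n
  have hpow : (n : ℝ) ^ ((n : ℝ) + 1 / 2) = (n : ℝ) ^ n * Real.sqrt n := by
    rw [Real.rpow_add h4, Real.rpow_natCast, Real.sqrt_eq_rpow]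
  have hsq : Real.sqrt n ≤ Real.sqrt (2 * Real.pi * n) := by
    refine Real.sqrt_le_sqrt ?_
    nlinarith [Real.pi_gt_three]
  have hexp : Real.exp n = Real.exp 1 ^ n := by rw [← Real.exp_nat_mul, mul_one]
  rw [hpow, inv_le_comm₀ (by positivity) (by positivity), inv_div]
  refine le_trans ?_ h
  rw [div_pow, hexp, mul_comm, mul_div_assoc]
  gcongr

/-- The reciprocal of `(n + 1)!` times the leading coefficient of the Gegenbauer polynomial of
degree `n + 1`, up to a power of two. -/
def errorRatio (α : ℝ) (n : ℕ) : ℝ :=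
  Real.Gamma (α + 1) * Real.Gamma (n + 2 * α + 1) /
    (Real.Gamma (2 * α + 1) * Real.Gamma (n + 2) * Real.Gamma (n + α + 1))

theorem Gamma_natCast_add_two (n : ℕ) : Real.Gamma ((n : ℝ) + 2) = (Nat.factorial (n + 1) : ℝ) := by
  rw [← Real.Gamma_nat_eq_factorial]
  push_cast
  congr 1
  ring

open Filter in
-- The quotient `Γ(n + 2 α + 1) / Γ(n + α + 1)` is of order `n ^ α`, and Stirling bounds `1 / (n +
-- 1)!` by `e ^ n / n ^ (n + 3/2)`.
theorem eventually_errorRatio_le (hα : -(1 / 2) < α) :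
    ∃ C : ℝ, 0 < C ∧ ∀ᶠ n : ℕ in atTop,
      errorRatio α n ≤ C * (Real.exp n / (n : ℝ) ^ ((n : ℝ) + 3 / 2 - α)) := by
  have hG1 := Real.Gamma_pos_of_pos (show 0 < α + 1 by linarith)
  have hG2 := Real.Gamma_pos_of_pos (show 0 < 2 * α + 1 by linarith)
  refine ⟨4 * (Real.Gamma (α + 1) / Real.Gamma (2 * α + 1)), by positivity, ?_⟩
  filter_upwards [eventually_Gamma_bounds (show -1 < 2 * α by linarith),
    eventually_Gamma_bounds (show -1 < α by linarith), eventually_ge_atTop 1] with n h1 h2 hn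
  have h4 : (0 : ℝ) < n := by exact_mod_cast hn
  have hfac : (0 : ℝ) < Nat.factorial n := by positivity
  have hp : (0 : ℝ) < (n : ℝ) ^ α := Real.rpow_pos_of_pos h4 _
  have hlow : 0 < (Nat.factorial n : ℝ) * (n : ℝ) ^ α / 2 := by positivity
  have hquot : Real.Gamma (n + 1 + 2 * α) / Real.Gamma (n + 1 + α) ≤ 4 * (n : ℝ) ^ α := by
    rw [div_le_iff₀ (hlow.trans_le h2.1)]
    calc _ ≤ _ := h1.2
      _ = 4 * (n : ℝ) ^ α * ((Nat.factorial n : ℝ) * (n : ℝ) ^ α / 2) := by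
        rw [two_mul α, Real.rpow_add h4]; ring
      _ ≤ _ := by gcongr; exact h2.1
  have hinv : (Real.Gamma ((n : ℝ) + 2))⁻¹ ≤
      (n : ℝ)⁻¹ * (Real.exp n / (n : ℝ) ^ ((n : ℝ) + 1 / 2)) := by
    rw [Gamma_natCast_add_two, Nat.factorial_succ, Nat.cast_mul, mul_inv]
    have := inv_factorial_le hn
    gcongr
    simp
  have hpow : (n : ℝ) ^ α * ((n : ℝ)⁻¹ * (Real.exp n / (n : ℝ) ^ ((n : ℝ) + 1 / 2))) =
      Real.exp n / (n : ℝ) ^ ((n : ℝ) + 3 / 2 - α) := by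
    have h5 : (n : ℝ) ^ ((n : ℝ) + 1 / 2) * n = (n : ℝ) ^ ((n : ℝ) + 3 / 2 - α) * (n : ℝ) ^ α := by
      rw [← Real.rpow_add_one h4.ne', ← Real.rpow_add h4]
      congr 1
      ring
    have h6 : (0 : ℝ) < (n : ℝ) ^ ((n : ℝ) + 1 / 2) := Real.rpow_pos_of_pos h4 _
    have h7 : (0 : ℝ) < (n : ℝ) ^ ((n : ℝ) + 3 / 2 - α) := Real.rpow_pos_of_pos h4 _
    rw [← mul_assoc, ← div_eq_mul_inv, div_mul_div_comm, div_eq_div_iff (by positivity) h7.ne']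
    linear_combination -Real.exp n * h5
  rw [errorRatio, show (n : ℝ) + 2 * α + 1 = n + 1 + 2 * α by ring,
    show (n : ℝ) + α + 1 = n + 1 + α by ring]
  have hΓ2 : 0 < Real.Gamma ((n : ℝ) + 2) := Real.Gamma_pos_of_pos (by positivity)
  calc _ = Real.Gamma (α + 1) / Real.Gamma (2 * α + 1) *
        (Real.Gamma (n + 1 + 2 * α) / Real.Gamma (n + 1 + α) * (Real.Gamma ((n : ℝ) + 2))⁻¹) := by
        rw [← div_eq_mul_inv, div_div, div_mul_div_comm]
        congr 1
        ring
    _ ≤ Real.Gamma (α + 1) / Real.Gamma (2 * α + 1) * (4 * (n : ℝ) ^ α *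
        ((n : ℝ)⁻¹ * (Real.exp n / (n : ℝ) ^ ((n : ℝ) + 1 / 2)))) := by gcongr
    _ = _ := by rw [← hpow]; ring

open Filter in
-- The central values are of order `k ^ (-α)` at `k` about `n / 2`; since `-α > 0` this only grows
-- when `k` is replaced by `n`.
theorem eventually_abs_gegenbauer_le (hα : -(1 / 2) < α) (hα0 : α < 0) :
    ∃ C : ℝ, 0 < C ∧ ∀ᶠ n : ℕ in atTop, ∀ t ∈ Set.Icc (-1 : ℝ) 1,
      |(gegenbauer α (n + 1)).eval t| ≤ C * (n : ℝ) ^ (-α) := by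
  obtain ⟨C, hC, h⟩ := eventually_evenCenter_le hα
  obtain ⟨K, hK⟩ := eventually_atTop.1 h
  have hs : 0 < Real.sqrt (1 + 2 * α) := Real.sqrt_pos.2 (by linarith)
  have hs1 : Real.sqrt (1 + 2 * α) ≤ 1 := Real.sqrt_le_one.2 (by linarith)
  refine ⟨C / Real.sqrt (1 + 2 * α), by positivity, ?_⟩
  filter_upwards [eventually_ge_atTop (2 * K + 1)] with n hn t ht
  have hcenter : ∀ k, K ≤ k → k ≤ n → evenCenter α k ≤ C * (n : ℝ) ^ (-α) := by
    intro k hk hkn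
    refine (hK k hk).trans ?_
    have : (k : ℝ) ^ (-α) ≤ (n : ℝ) ^ (-α) :=
      Real.rpow_le_rpow (Nat.cast_nonneg k) (by exact_mod_cast hkn) (by linarith)
    gcongr
  rcases Nat.even_or_odd' n with ⟨k, hk | hk⟩
  · have h1 := hcenter k (by omega) (by omega)
    have hk0 : (0 : ℝ) ≤ k := Nat.cast_nonneg k
    have h2 := abs_gegenbauer_odd_le hα hα0 k ht
    rw [abs_gegenbauer_eval_zero hα, ← evenCenter] at h2
    rw [show n + 1 = 2 * k + 1 by omega]
    refine h2.trans ?_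
    -- The extra factor of the odd-degree bound is at most `1 / √(1 + 2 α)`, uniformly in `k`.
    have hle : (2 * (k : ℝ) + 1) * Real.sqrt (1 + 2 * α) ≤
        Real.sqrt ((2 * (k : ℝ) + 1) * (2 * k + 1 + 2 * α)) := by
      refine Real.le_sqrt_of_sq_le ?_
      rw [mul_pow, Real.sq_sqrt (by linarith), sq, mul_assoc]
      refine mul_le_mul_of_nonneg_left ?_ (by positivity)
      nlinarith
    have hpos : 0 < (2 * (k : ℝ) + 1) * Real.sqrt (1 + 2 * α) := by positivity
    rw [div_mul_eq_mul_div, div_le_div_iff₀ (hpos.trans_le hle) hs]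
    have hg := evenCenter_pos hα k
    calc _ = evenCenter α k * ((2 * (k : ℝ) + 1) * Real.sqrt (1 + 2 * α)) := by ring
      _ ≤ _ := mul_le_mul h1 hle hpos.le (hg.le.trans h1)
  · have h1 := hcenter (k + 1) (by omega) (by omega)
    have h2 := abs_gegenbauer_even_le hα hα0 k ht
    rw [abs_gegenbauer_eval_zero hα, ← evenCenter] at h2
    rw [show n + 1 = 2 * (k + 1) by omega]
    refine h2.trans (h1.trans ?_)
    have : C ≤ C / Real.sqrt (1 + 2 * α) := by
      rw [le_div_iff₀ hs]
      nlinarith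
    gcongr

theorem abs_truncError_lt_errorRatio (hα : -(1 / 2) < α) (hl : 0 < l) (n q : ℕ) {f : ℝ → ℝ}
    (hf : ContDiffOn ℝ ((n + 1 : ℕ) : WithTop ℕ∞) f (Set.Icc 0 l)) (i : Fin (n + 1)) {A : ℝ}
    (hA0 : 0 < A)
    (hA : ∀ x ∈ Set.Ioo 0 l, |iteratedDerivWithin (n + 1)
      (fun y => (node α l n i - y) ^ q * f y) (Set.Icc 0 l) x| ≤ A)
    {M : ℝ} (hM : ∀ t ∈ Set.Icc (-1 : ℝ) 1, |(gegenbauer α (n + 1)).eval t| ≤ M) :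
    |truncError α l n (q + 1) f i| < A * node α l n i * l ^ (n + 1) /
      ((Nat.factorial q : ℝ) * 2 ^ (2 * n + 1)) * (errorRatio α n * M) := by
  have hM0 : 0 < M := by
    have := hM 1 ⟨by norm_num, le_rfl⟩
    rw [gegenbauer_eval_one hα, abs_one] at this
    linarith
  refine (abs_truncError_lt hα hl n q hf i hA0 hA hM0 hM).trans_eq ?_
  have hn : (0 : ℝ) ≤ n := Nat.cast_nonneg n
  have h1 := (Real.Gamma_pos_of_pos (show 0 < n + α + 1 by linarith)).ne'
  have h2 := (Real.Gamma_pos_of_pos (show 0 < 2 * α + 1 by linarith)).ne'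
  have h3 := (Real.Gamma_pos_of_pos (show 0 < α + 1 by linarith)).ne'
  have h4 := (Real.Gamma_pos_of_pos (show 0 < n + 2 * α + 1 by linarith)).ne'
  rw [gegenbauerLead, errorRatio, Gamma_natCast_add_two, div_pow]
  field_simp
  ring

end

/-! ### The error bound in closed form -/

section
variable {α l : ℝ}

theorem evenCenter_eq_of_odd (hα : -(1 / 2) < α) (hα0 : α < 0) {n : ℕ} (hn : Odd n) :
    evenCenter α ((n + 1) / 2) =
      (Nat.factorial (n + 1) : ℝ) * |Real.Gamma (2 * α)| / Real.Gamma (n + 2 * α + 1) *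
        |Ring.choose (((n : ℝ) + 1) / 2 + α - 1) ((n + 1) / 2)| := by
  obtain ⟨k, rfl⟩ := hn
  have hk : (0 : ℝ) ≤ k := Nat.cast_nonneg k
  have hdiv : (2 * k + 1 + 1) / 2 = k + 1 := by omega
  rw [hdiv, evenCenter_eq_of_neg hα hα0, show 2 * (k + 1) = 2 * k + 1 + 1 by ring]
  push_cast
  rw [show 2 * (k : ℝ) + 1 + 2 * α + 1 = 2 * (k + 1) + 2 * α by ring,
    show (2 * (k : ℝ) + 1 + 1) / 2 = k + 1 by ring,
    abs_of_pos (Real.Gamma_pos_of_pos (show 0 < 2 * ((k : ℝ) + 1) + 2 * α by linarith))]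

/-- Here `|Γ(α)| |α| = Γ(α + 1)`, and the central value cancels both `Γ(n + 2 α + 1)` and the
factorial in the error ratio. -/
theorem errorRatio_mul_of_even (hα : -(1 / 2) < α) (hα0 : α < 0) {n : ℕ} (hn : Even n) :
    errorRatio α n * (((n : ℝ) + 1) * evenCenter α (n / 2) /
        Real.sqrt (((n : ℝ) + 1) * (n + 1 + 2 * α))) =
      |Real.Gamma α| * |α| /
        (Real.sqrt (((n : ℝ) + 1) * (2 * α + n + 1)) * Real.Gamma (n + α + 1)) *
          |Ring.choose ((n : ℝ) / 2 + α) (n / 2)| := by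
  obtain ⟨k, rfl⟩ := hn
  rw [← two_mul, Nat.mul_div_cancel_left k two_pos]
  have hk : (0 : ℝ) ≤ k := Nat.cast_nonneg k
  have h1 := Real.Gamma_pos_of_pos (show 0 < 2 * k + α + 1 by linarith)
  have h2 := Real.Gamma_pos_of_pos (show 0 < 2 * α + 1 by linarith)
  have h3 := Real.Gamma_pos_of_pos (show 0 < α + 1 by linarith)
  have h4 := Real.Gamma_pos_of_pos (show 0 < 2 * k + 2 * α + 1 by linarith)
  have hch : 0 < Ring.choose ((k : ℝ) + α) k := by
    have h := evenCenter_pos hα k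
    rw [evenCenter_eq hα] at h
    exact pos_of_mul_pos_left h (by positivity)
  have hG : |Real.Gamma α| * |α| = Real.Gamma (α + 1) := by
    rw [← abs_mul, mul_comm, ← Real.Gamma_add_one hα0.ne, abs_of_pos h3]
  have hs : 0 < Real.sqrt ((2 * (k : ℝ) + 1) * (2 * k + 1 + 2 * α)) := by
    refine Real.sqrt_pos.2 (mul_pos ?_ ?_) <;> linarith
  rw [hG, evenCenter_eq hα, errorRatio, Gamma_natCast_add_two, Nat.factorial_succ]
  push_cast
  rw [show 2 * (k : ℝ) / 2 + α = k + α by ring, abs_of_pos hch,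
    show 2 * α + 2 * (k : ℝ) + 1 = 2 * k + 1 + 2 * α by ring]
  have h5 := h1.ne'
  have h6 := h2.ne'
  have h7 := h4.ne'
  have h8 := hs.ne'
  generalize Real.Gamma (2 * k + α + 1) = a at *
  generalize Real.Gamma (2 * α + 1) = b at *
  generalize Real.Gamma (2 * k + 2 * α + 1) = c at *
  generalize Real.sqrt ((2 * (k : ℝ) + 1) * (2 * k + 1 + 2 * α)) = d at *
  field_simp

end

end BSGQ
end

theorem mainTheorem4 (α : ℝ) (hα : -(1 / 2) < α) :
    ∃ D₁ D₂ : ℝ, 0 < D₁ ∧ 0 < D₂ ∧ ∃ N : ℕ,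
      ∀ (l : ℝ) (_ : 0 < l) (n q : ℕ) (_ : 1 ≤ q) (f : ℝ → ℝ)
        (_ : ContDiffOn ℝ ((n + 1 : ℕ) : WithTop ℕ∞) f (Set.Icc 0 l))
        (i : Fin (n + 1)) (A : ℝ) (_ : 0 < A)
        (_ : ∀ x ∈ Set.Ioo 0 l,
          |iteratedDerivWithin (n + 1)
            (fun y => (BSGQ.node α l n i - y) ^ (q - 1) * f y) (Set.Icc 0 l) x| ≤ A),
        (0 ≤ α →
          |BSGQ.truncError α l n q f i| ≤
            A * (2 : ℝ) ^ (-2 * (n : ℝ) - 1) * Real.Gamma (α + 1) * BSGQ.node α l n i *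
                l ^ (n + 1) * Real.Gamma (n + 2 * α + 1) /
              ((Nat.factorial (q - 1) : ℝ) * Real.Gamma (2 * α + 1) * Real.Gamma (n + 2) *
                Real.Gamma (n + α + 1))) ∧
        (α < 0 → Odd n →
          |BSGQ.truncError α l n q f i| ≤
            A * (2 : ℝ) ^ (-2 * (n : ℝ) - 1) * Real.Gamma (α + 1) * BSGQ.node α l n i *
                l ^ (n + 1) * Real.Gamma (n + 2 * α + 1) /
              ((Nat.factorial (q - 1) : ℝ) * Real.Gamma (2 * α + 1) * Real.Gamma (n + 2) *
                Real.Gamma (n + α + 1)) *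
            ((Nat.factorial (n + 1) : ℝ) * |Real.Gamma (2 * α)| / Real.Gamma (n + 2 * α + 1) *
              |Ring.choose (((n : ℝ) + 1) / 2 + α - 1) ((n + 1) / 2)|)) ∧
        (α < 0 → Even n →
          |BSGQ.truncError α l n q f i| <
            A * (2 : ℝ) ^ (-2 * (n : ℝ) - 1) * |Real.Gamma α| * |α| * BSGQ.node α l n i *
                l ^ (n + 1) /
              ((Nat.factorial (q - 1) : ℝ) * Real.sqrt (((n : ℝ) + 1) * (2 * α + n + 1)) *
                Real.Gamma (n + α + 1)) *
            |Ring.choose ((n : ℝ) / 2 + α) (n / 2)|) ∧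
        (0 ≤ α → N ≤ n →
          |BSGQ.truncError α l n q f i| ≤
            A * D₁ * (Real.exp n * l ^ (n + 1) * BSGQ.node α l n i /
              ((2 : ℝ) ^ (2 * n + 1) * (n : ℝ) ^ ((n : ℝ) + 3 / 2 - α) *
                (Nat.factorial (q - 1) : ℝ)))) ∧
        (α < 0 → N ≤ n →
          |BSGQ.truncError α l n q f i| ≤
            A * D₁ * D₂ * (Real.exp n * l ^ (n + 1) * BSGQ.node α l n i /
              ((2 : ℝ) ^ (2 * n + 1) * (n : ℝ) ^ ((n : ℝ) + 3 / 2) *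
                (Nat.factorial (q - 1) : ℝ)))) := by
  obtain ⟨D₁, hD₁, h1⟩ := BSGQ.eventually_errorRatio_le hα
  -- For `α ≥ 0` the constant `D₂` plays no role, so `1` serves.
  have hbound : ∃ D₂ : ℝ, 0 < D₂ ∧ (α < 0 → ∀ᶠ n : ℕ in Filter.atTop, ∀ t ∈ Set.Icc (-1 : ℝ) 1,
      |(BSGQ.gegenbauer α (n + 1)).eval t| ≤ D₂ * (n : ℝ) ^ (-α)) := by
    by_cases hα0 : α < 0
    · obtain ⟨D₂, hD₂, h2⟩ := BSGQ.eventually_abs_gegenbauer_le hα hα0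
      exact ⟨D₂, hD₂, fun _ => h2⟩
    · exact ⟨1, one_pos, fun h => absurd h hα0⟩
  obtain ⟨D₂, hD₂, h2⟩ := hbound
  obtain ⟨N₁, hN₁⟩ := Filter.eventually_atTop.1 h1
  obtain ⟨N₂, hN₂⟩ : ∃ N₂ : ℕ, α < 0 → ∀ n ≥ N₂, ∀ t ∈ Set.Icc (-1 : ℝ) 1,
      |(BSGQ.gegenbauer α (n + 1)).eval t| ≤ D₂ * (n : ℝ) ^ (-α) := by
    by_cases hα0 : α < 0
    · obtain ⟨N₂, h⟩ := Filter.eventually_atTop.1 (h2 hα0)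
      exact ⟨N₂, fun _ => h⟩
    · exact ⟨0, fun h => absurd h hα0⟩
  -- The `1` in the maximum ensures `n > 0`, so that real powers of `n` can be split.
  refine ⟨D₁, D₂, hD₁, hD₂, max 1 (max N₁ N₂), ?_⟩
  intro l hl n q hq f hf i A hA0 hA
  obtain ⟨q, rfl⟩ := Nat.exists_eq_add_of_le' hq
  rw [Nat.add_sub_cancel] at *
  have key := fun M hM => BSGQ.abs_truncError_lt_errorRatio hα hl n q hf i hA0 hA (M := M) hM
  have hx := (BSGQ.node_mem_Ioo hα hl n i).1
  have hpref : 0 < A * BSGQ.node α l n i * l ^ (n + 1) /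
      ((Nat.factorial q : ℝ) * 2 ^ (2 * n + 1)) := by positivity
  have htwo : (2 : ℝ) ^ (-2 * (n : ℝ) - 1) = (2 ^ (2 * n + 1))⁻¹ := by
    rw [show -2 * (n : ℝ) - 1 = -((2 * n + 1 : ℕ) : ℝ) by push_cast; ring, Real.rpow_neg two_pos.le,
      Real.rpow_natCast]
  have hform : A * (2 : ℝ) ^ (-2 * (n : ℝ) - 1) * Real.Gamma (α + 1) * BSGQ.node α l n i *
      l ^ (n + 1) * Real.Gamma (n + 2 * α + 1) /
      ((Nat.factorial q : ℝ) * Real.Gamma (2 * α + 1) * Real.Gamma (n + 2) *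
        Real.Gamma (n + α + 1)) = A * BSGQ.node α l n i * l ^ (n + 1) /
      ((Nat.factorial q : ℝ) * 2 ^ (2 * n + 1)) * BSGQ.errorRatio α n := by
    rw [htwo, BSGQ.errorRatio, div_mul_div_comm, ← div_eq_mul_inv, div_mul_eq_mul_div,
      div_mul_eq_mul_div, div_mul_eq_mul_div, div_mul_eq_mul_div, div_div]
    congr 1 <;> ring
  refine ⟨fun h0 => ?_, fun h0 hn => ?_, fun h0 hn => ?_, fun h0 hn => ?_, fun h0 hn => ?_⟩
  · rw [hform]
    have h := key 1 fun t ht => BSGQ.abs_gegenbauer_le_one h0 (n + 1) ht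
    rw [mul_one] at h
    exact h.le
  · rw [hform, ← BSGQ.evenCenter_eq_of_odd hα h0 hn, mul_assoc]
    refine (key _ fun t ht => ?_).le
    obtain ⟨k, rfl⟩ := hn
    have h := BSGQ.abs_gegenbauer_even_le hα h0 k ht
    rw [BSGQ.abs_gegenbauer_eval_zero hα, ← BSGQ.evenCenter] at h
    rwa [show (2 * k + 1 + 1) / 2 = k + 1 by omega, show 2 * k + 1 + 1 = 2 * (k + 1) by ring]
  · have hrhs : A * (2 : ℝ) ^ (-2 * (n : ℝ) - 1) * |Real.Gamma α| * |α| * BSGQ.node α l n i *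
        l ^ (n + 1) / ((Nat.factorial q : ℝ) * Real.sqrt (((n : ℝ) + 1) * (2 * α + n + 1)) *
          Real.Gamma (n + α + 1)) * |Ring.choose ((n : ℝ) / 2 + α) (n / 2)| =
        A * BSGQ.node α l n i * l ^ (n + 1) / ((Nat.factorial q : ℝ) * 2 ^ (2 * n + 1)) *
          (|Real.Gamma α| * |α| /
            (Real.sqrt (((n : ℝ) + 1) * (2 * α + n + 1)) * Real.Gamma (n + α + 1)) *
          |Ring.choose ((n : ℝ) / 2 + α) (n / 2)|) := by
      rw [htwo, ← mul_assoc, div_mul_div_comm]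
      congr 1
      rw [← div_eq_mul_inv, div_mul_eq_mul_div, div_mul_eq_mul_div, div_mul_eq_mul_div,
        div_mul_eq_mul_div, div_div]
      congr 1 <;> ring
    rw [hrhs, ← BSGQ.errorRatio_mul_of_even hα h0 hn]
    refine key _ fun t ht => ?_
    obtain ⟨k, rfl⟩ := hn
    have h := BSGQ.abs_gegenbauer_odd_le hα h0 k ht
    rw [BSGQ.abs_gegenbauer_eval_zero hα, ← BSGQ.evenCenter] at h
    rw [← two_mul, Nat.mul_div_cancel_left k two_pos]
    push_cast
    exact h
  · have hn1 : N₁ ≤ n := le_trans (by simp) hn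
    have h := key 1 fun t ht => BSGQ.abs_gegenbauer_le_one h0 (n + 1) ht
    rw [mul_one] at h
    refine h.le.trans ((mul_le_mul_of_nonneg_left (hN₁ n hn1) hpref.le).trans_eq ?_)
    rw [mul_comm D₁, ← mul_assoc, div_mul_div_comm, mul_div_assoc', div_mul_eq_mul_div]
    congr 1 <;> ring
  · have hn1 : N₁ ≤ n := le_trans (by simp) hn
    have hn2 : N₂ ≤ n := le_trans (by simp) hn
    have hn0 : (0 : ℝ) < n := by exact_mod_cast le_trans (by simp) hn
    have h := key _ (hN₂ h0 n hn2)
    have hpow : (0 : ℝ) < (n : ℝ) ^ (-α) := Real.rpow_pos_of_pos hn0 _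
    have hpow2 : (0 : ℝ) < (n : ℝ) ^ ((n : ℝ) + 3 / 2) := Real.rpow_pos_of_pos hn0 _
    have h3 := mul_le_mul_of_nonneg_right (hN₁ n hn1) (mul_pos hD₂ hpow).le
    refine h.le.trans ((mul_le_mul_of_nonneg_left h3 hpref.le).trans_eq ?_)
    -- The growth `n ^ (-α)` of the Gegenbauer maximum cancels the `-α` in the exponent of the error
    -- ratio.
    rw [sub_eq_add_neg, Real.rpow_add hn0]
    field_simp
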